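/- Let $S_n$ be the set of permutations of $[n]=\{1,\dots,n\}$, $n\ge 0$, and for a pattern $\tau$ let $S_n(\tau)\subseteq S_n$ be the set of $\tau$-avoiding permutations. For $\sigma\in S_n$ let $\mathrm{crs}(\sigma)$ be the number of crossings of $\sigma$, i.e. of pairs $(i,j)$ with $i<j<\sigma(i)<\sigma(j)$ or $\sigma(i)<\sigma(j)\le i<j$. The Elizalde–Pak map $\Theta=\Phi^{-1}\circ\Psi$ is defined as follows. (1) Let $\sigma\in S_n(321)$ and let $(P,Q)$ be its pair of insertion and recording tableaux under the Robinson–Schensted–Knuth correspondence; they have at most two rows. The Dyck path $\Psi(\sigma)$ of semilength $n$ is the word in the up-step $u$ and the down-step $d$ obtained by writing, for $i=1,\dots,n$, the letter $u$ if $i$ is in the first row of $P$ and $d$ if $i$ is in the second row of $P$, and then, for $j=n,n-1,\dots,1$, the letter $u$ if $j$ is in the second row of $Q$ and $d$ if $j$ is in the first row of $Q$. (2) Let $D$ be a Dyck path of semilength $n$. Each up-step $u$ of $D$ is joined by a tunnel to exactly one down-step $d$ of $D$, namely the one for which $D=AuBdC$ with $B$ a Dyck path. From left to right, number the up-steps of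 $D$ by $n,n-1,\dots,1$ and the down-steps by $1,2,\dots,n$. Then $\pi=\Phi^{-1}(D)\in S_n$ is given by $\pi(n+1-i)=j$ if and only if the tunnel starting at the up-step numbered $n+1-i$ (the $i$-th up-step) ends at the down-step numbered $j$ (the $j$-th down-step). Theorem. For every $n\ge 0$, the map $\Theta$ is a well-defined bijection $S_n(321)\to S_n(132)$, and $\mathrm{crs}(\Theta(\sigma))=\mathrm{crs}(\sigma)$ for all $\sigma\in S_n(321)$. -/

import Mathlib

/-! Permutations of `[n] = {1, …, n}` are elements of `Equiv.Perm (Fin n)`: positions, values,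
tableau entries and the numbers attached to the steps of a path are all shifted by one, so that
they run through `0, …, n - 1`. -/

namespace ElizaldePak

/-- `σ` avoids the pattern `τ`: no subsequence `σ(i₁) … σ(iₖ)`, `i₁ < … < iₖ`, has the same relative
order as `τ(1) … τ(k)`. -/
def Avoids {k n : ℕ} (τ : Equiv.Perm (Fin k)) (σ : Equiv.Perm (Fin n)) : Prop :=
  ¬ ∃ f : Fin k ↪o Fin n, ∀ a b : Fin k, σ (f a) < σ (f b) ↔ τ a < τ b

/-- `S_n(τ)`, the set of `τ`-avoiding permutations of `[n]`. -/
def Av (n : ℕ) {k : ℕ} (τ : Equiv.Perm (Fin k)) : Type :=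
  {σ : Equiv.Perm (Fin n) // Avoids τ σ}

/-- The pattern `321`. -/
def p321 : Equiv.Perm (Fin 3) := Fin.revPerm

/-- The pattern `132`. -/
def p132 : Equiv.Perm (Fin 3) := Equiv.swap 1 2

/-- The number of crossings: pairs `(i, j)` with `i < j < σ(i) < σ(j)` or
`σ(i) < σ(j) ≤ i < j`. -/
def crs {n : ℕ} (σ : Equiv.Perm (Fin n)) : ℕ :=
  (Finset.univ.filter fun p : Fin n × Fin n =>
    (p.1 < p.2 ∧ p.2 < σ p.1 ∧ σ p.1 < σ p.2) ∨
    (σ p.1 < σ p.2 ∧ σ p.2 ≤ p.1 ∧ p.1 < p.2)).card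

/-- Row insertion of `x`: `x` replaces the leftmost entry larger than `x`, which is returned as the
bumped entry; if there is none, `x` is placed at the end of the row. -/
def rowInsert (x : ℕ) : List ℕ → List ℕ × Option ℕ
  | [] => ([x], none)
  | y :: ys =>
    if x < y then (x :: ys, some y)
    else (y :: (rowInsert x ys).1, (rowInsert x ys).2)

/-- One step of the Robinson–Schensted–Knuth algorithm. A pair `(P, Q)` of tableaux of the same
shape is stored as the list of pairs (row of `P`, row of `Q`), top row first; `x` is inserted into
`P`, and `i` is recorded in `Q` at the position of the new square. -/
def rskInsert (x i : ℕ) : List (List ℕ × List ℕ) → List (List ℕ × List ℕ)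
  | [] => [([x], [i])]
  | (p, q) :: T =>
    match rowInsert x p with
    | (p', none) => (p', q ++ [i]) :: T
    | (p', some y) => (p', q) :: rskInsert y i T

/-- The pair `(P, Q) = RSK(σ)`: insert `(i, σ(i))` for `i` from first to last. -/
def rsk {n : ℕ} (σ : Equiv.Perm (Fin n)) : List (List ℕ × List ℕ) :=
  (List.finRange n).foldl (fun T i => rskInsert (σ i) i T) []

/-- The first rows of `P` and of `Q`, where `(P, Q) = RSK(σ)`. -/
def firstRows {n : ℕ} (σ : Equiv.Perm (Fin n)) : List ℕ × List ℕ :=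
  (rsk σ).headD ([], [])

/-- The lattice path `Ψ(σ)`, for a `321`-avoiding `σ`. First half: for each number `i` in increasing
order, an up-step if `i` is in the first row of `P`, a down-step otherwise (that is, if `i` is in
the second row, as `P` and `Q` have at most two rows). Second half: for each number `j` in
decreasing order, a down-step if `j` is in the first row of `Q`, an up-step otherwise. -/
def psi {n : ℕ} (σ : Equiv.Perm (Fin n)) : List DyckStep :=
  (List.range n).map (fun i => if i ∈ (firstRows σ).1 then DyckStep.U else DyckStep.D) ++
  (List.range n).reverse.map (fun j => if j ∈ (firstRows σ).2 then DyckStep.D else DyckStep.U)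

/-- The path `w` is a Dyck path of semilength `n`. -/
def IsDyckPath (n : ℕ) (w : List DyckStep) : Prop :=
  ∃ p : DyckWord, p.toList = w ∧ p.semilength = n

/-- There is a tunnel of the path `w` from its up-step number `a` to its down-step number `b`, both
counted from the left and starting with `0`: that is, `w = A u B d C` with `B` a Dyck path, where
exactly `a` up-steps precede this `u` and exactly `b` down-steps precede this `d`. -/
def IsTunnel (w : List DyckStep) (a b : ℕ) : Prop :=
  ∃ (A : List DyckStep) (B : DyckWord) (C : List DyckStep),
    w = A ++ DyckStep.U :: (B.toList ++ DyckStep.D :: C) ∧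
    A.count DyckStep.U = a ∧
    (A ++ DyckStep.U :: B.toList).count DyckStep.D = b

/-- `π = Φ⁻¹(w)`: number the up-steps of `w` from left to right by `n, …, 1` and the down-steps by
`1, …, n`; then `π` sends the number of an up-step to the number of the down-step at which the
tunnel from this up-step ends. Such a `π` is determined by `w`. -/
def IsPhiInv {n : ℕ} (w : List DyckStep) (π : Equiv.Perm (Fin n)) : Prop :=
  ∀ a b : Fin n, π a.rev = b ↔ IsTunnel w a b

/-- `Θ = Φ⁻¹ ∘ Ψ`: for all `321`-avoiding `σ`, the path `Ψ(σ)` is a Dyck path of semilength `n`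
and `Θ(σ) = Φ⁻¹(Ψ(σ))`. At most one map `Θ` satisfies this. -/
def IsElizaldePakMap {n : ℕ} (Θ : Av n p321 → Av n p132) : Prop :=
  ∀ σ : Av n p321, IsDyckPath n (psi σ.1) ∧ IsPhiInv (psi σ.1) (Θ σ).1

/-- The conditions determine `Θ`. -/
theorem IsElizaldePakMap.unique {n : ℕ} {Θ Θ' : Av n p321 → Av n p132}
    (h : IsElizaldePakMap Θ) (h' : IsElizaldePakMap Θ') : Θ = Θ' := by
  funext σ
  refine Subtype.ext (Equiv.ext fun i => ?_)
  have h1 := ((h σ).2 i.rev ((Θ σ).1 i)).1 (by rw [Fin.rev_rev])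
  have h2 := ((h' σ).2 i.rev ((Θ σ).1 i)).2 h1
  rw [Fin.rev_rev] at h2
  exact h2.symm

end ElizaldePak

/-! Crossings on both sides are compared with one sum attached to `σ`. Draw an arc from each
position to its image, opened at its lower end: an excedance opens at its position, any other arc at
its value. Charging pairs of arcs to the arc that opens later shows, for every permutation, that
`crs + sameInv + exc` and `mixedInv` both equal `cutSum` (`crs_add_sameInv`, `mixedInv_eq`). Hence
`crs + exc` is minus the sum, over all inversions, of the product of the two signs. If `σ` avoids
321, every inversion joins an excedance to a non-excedance, so `crs σ + exc σ = cutSum σ`.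

For `π = Φ⁻¹(w)`, inversions are the pairs of disjoint tunnels, and excedances are the tunnels
centred strictly to the right of the middle of the path (`TunnelEnds.lt_apply_iff`). The core is
`exists_opener_equiv`: when `psi σ` is read from both ends towards the middle, its tunnels open
exactly at the excedance positions of `σ` on the right and at its non-excedance values on the left.
This follows by comparing the heights of the two halves with a common lower bound, `floorHeight`,
which each half touches at controlled places (`exists_floor_step`). With the tunnels sorted by
opening time, the signed count of earlier disjoint tunnels at each opening is, up to sign, the
matching term of `cutSum σ`. So `crs π + exc π = cutSum σ`, and the excedance numbers agree.

The same matching recovers the excedance positions and values of `σ` from `psi σ`, which determine a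
321-avoiding permutation; with `IsPhiInv.path_unique` this makes `Θ` injective. An injection in the
other direction, through running extrema, equates the cardinalities, so `Θ` is bijective. -/

namespace ElizaldePak

open Finset DyckStep

/-! ### Crossings, inversions and arcs over a gap -/

section Counting

variable {n : ℕ}

/-- The number of arcs `i → π i` that pass from below `k` to `k` or above. -/
def cut (π : Equiv.Perm (Fin n)) (k : ℕ) : ℕ := #{i : Fin n | (i : ℕ) < k ∧ k ≤ π i}

/-- The number of inversions of `π` formed by two excedances or by two non-excedances. -/
def sameInv (π : Equiv.Perm (Fin n)) : ℕ :=
  #{p : Fin n × Fin n | p.1 < p.2 ∧ π p.2 < π p.1 ∧ (p.1 < π p.1 ↔ p.2 < π p.2)}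

/-- The number of inversions of `π` formed by an excedance and a non-excedance. -/
def mixedInv (π : Equiv.Perm (Fin n)) : ℕ :=
  #{p : Fin n × Fin n | p.1 < p.2 ∧ π p.2 < π p.1 ∧ ¬ (p.1 < π p.1 ↔ p.2 < π p.2)}

/-- The number of excedances of `π`. -/
def exc (π : Equiv.Perm (Fin n)) : ℕ := #{i : Fin n | i < π i}

/-- The total of `cut` over the steps that open an arc. -/
def cutSum (π : Equiv.Perm (Fin n)) : ℕ :=
  ∑ j : Fin n, if j < π j then cut π (j + 1) else cut π (π j)

theorem card_lt_perm (π : Equiv.Perm (Fin n)) (k : ℕ) :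
    #{i : Fin n | (π i : ℕ) < k} = #{i : Fin n | (i : ℕ) < k} :=
  Finset.card_bij (fun i _ => π i) (by simp) (by simp) (fun b hb => ⟨π.symm b, by simpa using hb⟩)

/-- Exactly as many positions as values lie below `k`, so upward and downward arcs over the gap
balance. -/
theorem cut_eq (π : Equiv.Perm (Fin n)) (k : ℕ) :
    cut π k = #{i : Fin n | (π i : ℕ) < k ∧ k ≤ i} := by
  have h := card_lt_perm π k
  have h1 : #{i : Fin n | (π i : ℕ) < k} =
      #{i : Fin n | (π i : ℕ) < k ∧ k ≤ i} + #{i : Fin n | (π i : ℕ) < k ∧ (i : ℕ) < k} := by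
    simp only [card_filter, ← sum_add_distrib]
    refine sum_congr rfl fun i _ => ?_
    split_ifs <;> omega
  have h2 : #{i : Fin n | (i : ℕ) < k} =
      cut π k + #{i : Fin n | (π i : ℕ) < k ∧ (i : ℕ) < k} := by
    simp only [cut, card_filter, ← sum_add_distrib]
    refine sum_congr rfl fun i _ => ?_
    split_ifs <;> omega
  omega

theorem card_fin_lt {k : ℕ} (hk : k ≤ n) : #{i : Fin n | (i : ℕ) < k} = k := by
  rw [Fin.card_filter_val_lt, min_eq_right hk]

/-- The right side counts arcs whose lower end is below `k`. Of these, `k` have their value below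
`k`; the others go up over the gap. -/
theorem cut_add (π : Equiv.Perm (Fin n)) {k : ℕ} (hk : k ≤ n) :
    cut π k + k = #{i : Fin n | i < π i ∧ (i : ℕ) < k} +
      #{i : Fin n | ¬ i < π i ∧ (π i : ℕ) < k} := by
  have h := card_lt_perm π k
  rw [card_fin_lt hk] at h
  suffices H : cut π k + #{i : Fin n | (π i : ℕ) < k} = #{i : Fin n | i < π i ∧ (i : ℕ) < k} +
      #{i : Fin n | ¬ i < π i ∧ (π i : ℕ) < k} by rwa [h] at H
  simp only [cut, card_filter, ← sum_add_distrib]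
  refine sum_congr rfl fun i _ => ?_
  simp only [Fin.lt_def]
  split_ifs <;> omega

theorem perm_val_ne (π : Equiv.Perm (Fin n)) (i j : Fin n) :
    (i : ℕ) = j ↔ (π i : ℕ) = π j := by
  rw [Fin.val_inj, Fin.val_inj, π.injective.eq_iff]

/-- When arc `j` opens, each open arc of its own direction either crosses it or nests around it, and
nesting is an inversion of equal type. -/
theorem crs_add_sameInv (π : Equiv.Perm (Fin n)) :
    crs π + sameInv π + exc π = cutSum π := by
  have h1 : crs π + sameInv π = ∑ j : Fin n, ∑ i : Fin n,
      ((if i < j ∧ j < π i ∧ j < π j then 1 else 0) +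
        if ¬ j < π j ∧ π i < π j ∧ π j ≤ i then 1 else 0) := by
    have e1 : crs π = ∑ j : Fin n, ∑ i : Fin n,
        ((if i < j ∧ j < π i ∧ π i < π j then 1 else 0) +
          if π i < π j ∧ π j ≤ i ∧ i < j then 1 else 0) := by
      rw [crs, card_filter, Fintype.sum_prod_type, sum_comm]
      refine sum_congr rfl fun j _ => sum_congr rfl fun i _ => ?_
      simp only [Fin.lt_def, Fin.le_def]
      split_ifs <;> omega
    have e2 : sameInv π = ∑ j : Fin n, ∑ i : Fin n,
        ((if i < j ∧ π j < π i ∧ i < π i ∧ j < π j then 1 else 0) +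
          if j < i ∧ π i < π j ∧ ¬ i < π i ∧ ¬ j < π j then 1 else 0) := by
      simp only [sum_add_distrib]
      rw [sum_comm (f := fun j i => if j < i ∧ π i < π j ∧ ¬ i < π i ∧ ¬ j < π j then 1 else 0),
        sameInv, card_filter, Fintype.sum_prod_type, sum_comm]
      simp only [← sum_add_distrib]
      refine sum_congr rfl fun j _ => sum_congr rfl fun i _ => ?_
      simp only [Fin.lt_def]
      split_ifs <;> omega
    rw [e1, e2]
    simp only [← sum_add_distrib]
    refine sum_congr rfl fun j _ => sum_congr rfl fun i _ => ?_
    have := perm_val_ne π i j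
    simp only [Fin.lt_def, Fin.le_def]
    split_ifs <;> omega
  rw [h1, exc, card_filter, cutSum, ← sum_add_distrib]
  refine sum_congr rfl fun j _ => ?_
  split_ifs with hj
  -- An excedance `j` is itself among the arcs counted by `cut π (j + 1)`; this is where `exc`
  -- enters.
  · have : (1 : ℕ) = ∑ i : Fin n, if i = j then 1 else 0 := by simp
    rw [this, ← sum_add_distrib, cut, card_filter]
    refine sum_congr rfl fun i _ => ?_
    have : i = j → π i = π j := fun h => by rw [h]
    simp only [Fin.lt_def, Fin.le_def, Fin.ext_iff] at *
    split_ifs <;> omega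
  · rw [cut_eq, card_filter, add_zero]
    refine sum_congr rfl fun i _ => ?_
    simp only [Fin.lt_def, Fin.le_def] at *
    split_ifs <;> omega

/-- An upward and a downward arc form an inversion exactly when they overlap; the pair is charged to
the later opening, where the arcs of opposite direction are counted. A tie is charged to the
excedance. -/
theorem mixedInv_eq (π : Equiv.Perm (Fin n)) : mixedInv π = cutSum π := by
  have e1 : mixedInv π = ∑ j : Fin n, ∑ i : Fin n,
      ((if i < π j ∧ π j < π i ∧ i < π i ∧ ¬ j < π j then 1 else 0) +
        if π i ≤ j ∧ j < i ∧ j < π j then 1 else 0) := by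
    simp only [sum_add_distrib]
    rw [sum_comm (f := fun j i => if π i ≤ j ∧ j < i ∧ j < π j then 1 else 0),
      mixedInv, card_filter, Fintype.sum_prod_type, sum_comm]
    simp only [← sum_add_distrib]
    refine sum_congr rfl fun j _ => sum_congr rfl fun i _ => ?_
    have := perm_val_ne π i j
    simp only [Fin.lt_def, Fin.le_def]
    split_ifs <;> omega
  rw [e1, cutSum]
  refine sum_congr rfl fun j _ => ?_
  split_ifs with hj
  · rw [cut_eq, card_filter]
    refine sum_congr rfl fun i _ => ?_
    simp only [Fin.lt_def, Fin.le_def] at *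
    split_ifs <;> omega
  · rw [cut, card_filter]
    refine sum_congr rfl fun i _ => ?_
    have := perm_val_ne π i j
    simp only [Fin.lt_def, Fin.le_def] at *
    split_ifs <;> omega

/-- The sign of a position: `1` for an excedance, `-1` otherwise. -/
def sgn (π : Equiv.Perm (Fin n)) (i : Fin n) : ℤ := if i < π i then 1 else -1

theorem crs_add_exc (π : Equiv.Perm (Fin n)) :
    (crs π + exc π : ℤ) = - ∑ i : Fin n, ∑ j : Fin n,
      if i < j ∧ π j < π i then sgn π i * sgn π j else 0 := by
  have h1 := crs_add_sameInv π
  rw [← mixedInv_eq] at h1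
  have h2 : (crs π + exc π : ℤ) = mixedInv π - sameInv π := by
    have : (crs π + sameInv π + exc π : ℤ) = mixedInv π := by exact_mod_cast h1
    linarith
  rw [h2, mixedInv, sameInv, card_filter, card_filter, Fintype.sum_prod_type,
    Fintype.sum_prod_type]
  push_cast
  rw [← sum_sub_distrib, ← sum_neg_distrib]
  refine sum_congr rfl fun i _ => ?_
  rw [← sum_sub_distrib, ← sum_neg_distrib]
  refine sum_congr rfl fun j _ => ?_
  unfold sgn
  by_cases a : i < j ∧ π j < π i <;> by_cases b : i < π i <;> by_cases c : j < π j <;>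
    simp [a, b, c]

end Counting

/-! ### Structure of 321-avoiding permutations -/

section Avoid321

variable {n : ℕ} {σ : Equiv.Perm (Fin n)}

theorem not_avoids_of_three {τ : Equiv.Perm (Fin 3)} {a b c : Fin n} (hab : a < b) (hbc : b < c)
    (H : ∀ x y, σ (![a, b, c] x) < σ (![a, b, c] y) ↔ τ x < τ y) : ¬ Avoids τ σ := by
  refine fun h => h ⟨OrderEmbedding.ofStrictMono ![a, b, c] ?_, H⟩
  intro x y hxy
  have := hab.trans hbc
  fin_cases x <;> fin_cases y <;> simp_all

theorem Avoids.not_decreasing (h : Avoids p321 σ) {a b c : Fin n} (hab : a < b) (hbc : b < c)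
    (h1 : σ b < σ a) (h2 : σ c < σ b) : False := by
  have h3 := h2.trans h1
  refine not_avoids_of_three hab hbc (fun x y => ?_) h
  fin_cases x <;> fin_cases y <;> simp [p321, h1, h2, h3, h1.le, h2.le, h3.le]

/-- A larger value before `i` would complete a 321, so `σ t` and all the values before `i` lie below
`σ i`: that is one value more than there are positions before `i`. -/
theorem Avoids.inversion_left (h : Avoids p321 σ) {i t : Fin n} (hit : i < t) (hσ : σ t < σ i) :
    i < σ i := by
  by_contra hi
  have hsub : insert (σ t) ((Iio i).image σ) ⊆ Iio (σ i) := by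
    intro v hv
    simp only [mem_insert, mem_image, mem_Iio] at hv ⊢
    rcases hv with rfl | ⟨k, hk, rfl⟩
    · exact hσ
    · refine lt_of_le_of_ne (not_lt.1 fun hki => h.not_decreasing hk hit hki hσ) ?_
      exact fun e => hk.ne (σ.injective e)
  have hc := card_le_card hsub
  rw [card_insert_of_notMem, card_image_of_injective _ σ.injective] at hc
  · simp only [Fin.card_Iio] at hc
    omega
  · simp only [mem_image, mem_Iio, not_exists, not_and]
    intro k hk e
    exact (hk.trans hit).ne (σ.injective e)

theorem Avoids.inversion_right (h : Avoids p321 σ) {i t : Fin n} (hit : i < t) (hσ : σ t < σ i) :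
    σ t < t := by
  by_contra ht
  have hsub : insert (σ i) ((Ioi t).image σ) ⊆ Ioi (σ t) := by
    intro v hv
    simp only [mem_insert, mem_image, mem_Ioi] at hv ⊢
    rcases hv with rfl | ⟨k, hk, rfl⟩
    · exact hσ
    · refine lt_of_le_of_ne (not_lt.1 fun hki => h.not_decreasing hit hk hσ hki) ?_
      exact fun e => hk.ne (σ.injective e)
  have hc := card_le_card hsub
  rw [card_insert_of_notMem, card_image_of_injective _ σ.injective] at hc
  · simp only [Fin.card_Ioi] at hc
    omega
  · simp only [mem_image, mem_Ioi, not_exists, not_and]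
    intro k hk e
    exact (hit.trans hk).ne (σ.injective e).symm

theorem Avoids.sameInv_eq_zero (h : Avoids p321 σ) : sameInv σ = 0 := by
  rw [sameInv, card_eq_zero, filter_eq_empty_iff]
  rintro ⟨i, j⟩ - ⟨h1, h2, h3⟩
  exact (h.inversion_right h1 h2).not_gt (h3.1 (h.inversion_left h1 h2))

theorem Avoids.crs_add_exc (h : Avoids p321 σ) : crs σ + exc σ = cutSum σ := by
  rw [← crs_add_sameInv, h.sameInv_eq_zero, add_zero]

/-- The two ends of an inversion have different types, so `σ` increases on excedances and on
non-excedances. -/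
theorem Avoids.lt_of_apply_lt (h : Avoids p321 σ) {i j : Fin n} (hij : i < σ i ↔ j < σ j)
    (hσ : σ i < σ j) : i < j := by
  refine lt_of_le_of_ne (not_lt.1 fun hji => ?_) fun e => hσ.ne (congrArg σ e)
  exact (h.inversion_right hji hσ).not_gt (hij.2 (h.inversion_left hji hσ))

/-- A `321`-avoiding permutation is determined by its excedance positions and its excedance
values. -/
theorem Avoids.ext_excedance {σ' : Equiv.Perm (Fin n)} (h : Avoids p321 σ) (h' : Avoids p321 σ')
    (hpos : ∀ t, t < σ t ↔ t < σ' t) (hval : ∀ v, σ.symm v < v ↔ σ'.symm v < v) : σ = σ' := by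
  have key : ∀ {σ σ' : Equiv.Perm (Fin n)}, Avoids p321 σ' → (∀ t, t < σ t ↔ t < σ' t) →
      (∀ v, σ.symm v < v ↔ σ'.symm v < v) → ∀ t, (∀ s < t, σ s = σ' s) → ¬ σ t < σ' t := by
    intro σ σ' h' hpos hval t ih hlt
    -- At the first difference `t`, the smaller value `σ t` has in `σ'` the type of `t`, so
    -- monotonicity puts it before `t`, where the permutations agree.
    have hs : σ' (σ'.symm (σ t)) = σ t := σ'.apply_symm_apply _
    have h1 : σ'.symm (σ t) < t := by
      refine h'.lt_of_apply_lt ?_ (by rwa [hs])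
      rw [hs, ← hval, σ.symm_apply_apply, hpos]
    have h2 := ih _ h1
    rw [hs] at h2
    exact h1.ne (σ.injective h2)
  ext1 t
  induction t using WellFoundedLT.induction with
  | _ t ih =>
    refine le_antisymm (not_lt.1 ?_) (not_lt.1 ?_)
    · exact key h (fun t => (hpos t).symm) (fun v => (hval v).symm) t fun s hs => (ih s hs).symm
    · exact key h' hpos hval t ih

end Avoid321

/-! ### An injection from 132-avoiding to 321-avoiding permutations -/

section Cardinality

variable {n : ℕ}

/-- The running minima of `π` are the complements of the running maxima of `σ`. -/
def SameRecords (π σ : Equiv.Perm (Fin n)) : Prop :=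
  ∀ i v, (∃ j ≤ i, π j ≤ v) ↔ ∃ j ≤ i, v.rev ≤ σ j

theorem exists_decreasing {σ : Equiv.Perm (Fin n)} (h : ¬ Avoids p321 σ) :
    ∃ a b c, a < b ∧ b < c ∧ σ b < σ a ∧ σ c < σ b := by
  rw [Avoids, not_not] at h
  obtain ⟨f, hf⟩ := h
  exact ⟨f 0, f 1, f 2, f.strictMono (by decide), f.strictMono (by decide),
    (hf 1 0).2 (by decide), (hf 2 1).2 (by decide)⟩

/-- The two lower entries of a 321 lie below the earlier entry at `a`, so exchanging them leaves all
running maxima unchanged. -/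
theorem SameRecords.swap {π σ : Equiv.Perm (Fin n)} (h : SameRecords π σ) {a b c : Fin n}
    (hab : a < b) (hbc : b < c) (h1 : σ b < σ a) (h2 : σ c < σ b) :
    SameRecords π ((Equiv.swap b c).trans σ) := by
  intro i v
  rw [h]
  have key : ∀ {τ τ' : Equiv.Perm (Fin n)}, (∀ j, j ≠ b → j ≠ c → τ j = τ' j) → τ b ≤ τ' a →
      τ c ≤ τ' a → (∃ j ≤ i, v.rev ≤ τ j) → ∃ j ≤ i, v.rev ≤ τ' j := by
    rintro τ τ' hne hb hc ⟨j, hj, hv⟩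
    by_cases ejb : j = b
    · subst ejb
      exact ⟨a, hab.le.trans hj, hv.trans hb⟩
    · by_cases ejc : j = c
      · subst ejc
        exact ⟨a, (hab.trans hbc).le.trans hj, hv.trans hc⟩
      · exact ⟨j, hj, hne j ejb ejc ▸ hv⟩
  have ha : Equiv.swap b c a = a :=
    Equiv.swap_apply_of_ne_of_ne hab.ne (hab.trans hbc).ne
  constructor
  · refine key (fun j hjb hjc => ?_) ?_ ?_
    · rw [Equiv.trans_apply, Equiv.swap_apply_of_ne_of_ne hjb hjc]
    · rw [Equiv.trans_apply, ha]
      exact h1.le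
    · rw [Equiv.trans_apply, ha]
      exact (h2.trans h1).le
  · refine key (fun j hjb hjc => ?_) ?_ ?_
    · rw [Equiv.trans_apply, Equiv.swap_apply_of_ne_of_ne hjb hjc]
    · rw [Equiv.trans_apply, Equiv.swap_apply_left]
      exact (h2.trans h1).le
    · rw [Equiv.trans_apply, Equiv.swap_apply_right]
      exact h1.le

theorem exists_sameRecords (π : Equiv.Perm (Fin n)) :
    ∃ σ : Equiv.Perm (Fin n), Avoids p321 σ ∧ SameRecords π σ := by
  classical
  have hne : ({σ | SameRecords π σ} : Finset (Equiv.Perm (Fin n))).Nonempty := by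
    exact ⟨π.trans Fin.revPerm, mem_filter.2 ⟨mem_univ _, fun i v => by simp⟩⟩
  -- Sorting the two lower entries of a 321 raises this sum by `(c - b) * (σ b - σ c)`, so a
  -- maximizer has no 321.
  obtain ⟨σ, hσ, hmax⟩ := exists_max_image _
    (fun σ : Equiv.Perm (Fin n) => ∑ i : Fin n, (i : ℤ) * (σ i : ℕ)) hne
  simp only [mem_filter, mem_univ, true_and] at hσ hmax
  refine ⟨σ, ?_, hσ⟩
  by_contra hav
  obtain ⟨a, b, c, hab, hbc, h1, h2⟩ := exists_decreasing hav
  have h3 := hmax _ (hσ.swap hab hbc h1 h2)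
  rw [← sub_nonpos, ← sum_sub_distrib, Fintype.sum_eq_add b c hbc.ne] at h3
  · rw [Equiv.trans_apply, Equiv.trans_apply, Equiv.swap_apply_left, Equiv.swap_apply_right] at h3
    have h4 : (0 : ℤ) < ((c : ℤ) - b) * ((σ b : ℕ) - (σ c : ℕ)) :=
      mul_pos (by rw [Fin.lt_def] at hbc; omega) (by rw [Fin.lt_def] at h2; omega)
    linarith
  · rintro j ⟨hjb, hjc⟩
    rw [Equiv.trans_apply, Equiv.swap_apply_of_ne_of_ne hjb hjc, sub_self]

/-- Let `t` be the first difference, with `π t < π' t`. Equal running minima give an earlier entry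
of `π'` below `π t`, and `π'` takes the value `π t` only after `t`: a 132 in `π'`. -/
theorem SameRecords.injective {π π' σ : Equiv.Perm (Fin n)} (hπ : Avoids p132 π)
    (hπ' : Avoids p132 π') (h : SameRecords π σ) (h' : SameRecords π' σ) : π = π' := by
  have key : ∀ {π π' : Equiv.Perm (Fin n)}, Avoids p132 π' →
      (∀ i v, (∃ j ≤ i, π j ≤ v) ↔ ∃ j ≤ i, π' j ≤ v) →
      ∀ t, (∀ s < t, π s = π' s) → ¬ π t < π' t := by
    intro π π' hπ' hrec t ih hlt
    obtain ⟨a, ha, hav⟩ := (hrec t (π t)).1 ⟨t, le_rfl, le_rfl⟩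
    have hat : a < t := lt_of_le_of_ne ha (by rintro rfl; exact hlt.not_ge hav)
    have hav' : π' a < π t := by
      refine lt_of_le_of_ne hav fun e => ?_
      rw [← ih a hat] at e
      exact hat.ne (π.injective e)
    have hs : π' (π'.symm (π t)) = π t := π'.apply_symm_apply _
    have hts : t < π'.symm (π t) := by
      refine lt_of_le_of_ne (not_lt.1 fun hst => ?_) fun e => ?_
      · rw [← ih _ hst] at hs
        exact hst.ne (π.injective hs)
      · rw [← e] at hs
        exact hlt.ne hs.symm
    refine not_avoids_of_three hat hts (fun p q => ?_) hπ'
    have := hav'.trans hlt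
    fin_cases p <;> fin_cases q <;>
      simp [p132, Equiv.swap_apply_def, hav', hlt, this, hav'.le, hlt.le, this.le]
  have hrec : ∀ i v, (∃ j ≤ i, π j ≤ v) ↔ ∃ j ≤ i, π' j ≤ v := fun i v =>
    (h i v).trans (h' i v).symm
  ext1 t
  induction t using WellFoundedLT.induction with
  | _ t ih =>
    refine le_antisymm (not_lt.1 ?_) (not_lt.1 ?_)
    · exact key hπ (fun i v => (hrec i v).symm) t fun s hs => (ih s hs).symm
    · exact key hπ' hrec t ih

theorem exists_injective_av (n : ℕ) : ∃ f : Av n p132 → Av n p321, Function.Injective f := by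
  choose f hf hf' using fun π : Av n p132 => exists_sameRecords π.1
  refine ⟨fun π => ⟨f π, hf π⟩, fun π π' hπ => Subtype.ext ?_⟩
  have e : f π = f π' := congrArg Subtype.val hπ
  exact SameRecords.injective π.2 π'.2 (hf' π) (e ▸ hf' π')

end Cardinality

/-! ### The first rows of the tableaux and the bumping relation -/

section Insertion

theorem rowInsert_none {x : ℕ} {p : List ℕ} (h : (rowInsert x p).2 = none) :
    (∀ y ∈ p, ¬ x < y) ∧ (rowInsert x p).1 = p ++ [x] := by
  induction p with
  | nil => simp [rowInsert]
  | cons y ys ih =>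
    unfold rowInsert at h ⊢
    split_ifs at h ⊢ with hxy
    · simp only [List.mem_cons, forall_eq_or_imp]
      exact ⟨⟨hxy, (ih h).1⟩, by simp [(ih h).2]⟩

theorem rowInsert_some {x y : ℕ} {p : List ℕ} (hp : p.Pairwise (· < ·)) (hx : x ∉ p)
    (h : (rowInsert x p).2 = some y) :
    y ∈ p ∧ x < y ∧ (∀ z ∈ p, x < z → y ≤ z) ∧
      (∀ z, z ∈ (rowInsert x p).1 ↔ z = x ∨ z ∈ p ∧ z ≠ y) ∧
      (rowInsert x p).1.Pairwise (· < ·) := by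
  induction p with
  | nil => simp [rowInsert] at h
  | cons w ws ih =>
    rw [List.pairwise_cons] at hp
    rw [List.mem_cons, not_or] at hx
    unfold rowInsert at h ⊢
    split_ifs at h ⊢ with hxw
    · obtain rfl : w = y := by simpa using h
      refine ⟨List.mem_cons_self, hxw, ?_, ?_, ?_⟩
      · intro z hz _
        rcases List.mem_cons.1 hz with rfl | hz
        · exact le_rfl
        · exact (hp.1 z hz).le
      · intro z
        simp only [List.mem_cons]
        have : z ∈ ws → z ≠ w := fun hz => (hp.1 z hz).ne'
        tauto
      · exact List.pairwise_cons.2 ⟨fun z hz => hxw.trans (hp.1 z hz), hp.2⟩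
    · obtain ⟨h1, h2, h3, h4, h5⟩ := ih hp.2 hx.2 h
      refine ⟨List.mem_cons_of_mem _ h1, h2, ?_, ?_, ?_⟩
      · intro z hz hxz
        rcases List.mem_cons.1 hz with rfl | hz
        · exact absurd hxz hxw
        · exact h3 z hz hxz
      · intro z
        have : w ≠ y := (hp.1 y h1).ne
        simp only [List.mem_cons, h4]
        constructor
        · rintro (rfl | rfl | h)
          · tauto
          · tauto
          · tauto
        · tauto
      · refine List.pairwise_cons.2 ⟨fun z hz => ?_, h5⟩
        rcases (h4 z).1 hz with rfl | ⟨hz, _⟩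
        · omega
        · exact hp.1 z hz

/-- The effect of one step of the Robinson–Schensted–Knuth algorithm on the first rows. -/
def firstRowInsert (s : List ℕ × List ℕ) (x i : ℕ) : List ℕ × List ℕ :=
  ((rowInsert x s.1).1, if (rowInsert x s.1).2 = none then s.2 ++ [i] else s.2)

/-- Lower rows never influence the first row, so `psi` needs only this reduced algorithm. -/
theorem headD_rskInsert (x i : ℕ) (T : List (List ℕ × List ℕ)) :
    (rskInsert x i T).headD ([], []) = firstRowInsert (T.headD ([], [])) x i := by
  rcases T with _ | ⟨⟨p, q⟩, T⟩
  · simp [rskInsert, firstRowInsert, rowInsert]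
  · rcases h : rowInsert x p with ⟨p', _ | y⟩ <;> simp [rskInsert, firstRowInsert, h]

variable {n : ℕ} (σ : Equiv.Perm (Fin n))

/-- The first rows after `k` insertions. -/
def partialRows (k : ℕ) : List ℕ × List ℕ :=
  ((List.finRange n).take k).foldl (fun s i => firstRowInsert s (σ i) i) ([], [])

theorem firstRows_eq : firstRows σ = partialRows σ n := by
  have h : ∀ (l : List (Fin n)) (T : List (List ℕ × List ℕ)),
      (l.foldl (fun T i => rskInsert (σ i) i T) T).headD ([], []) =
        l.foldl (fun s i => firstRowInsert s (σ i) i) (T.headD ([], [])) := by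
    intro l
    induction l with
    | nil => intro T; rfl
    | cons a l ih => intro T; rw [List.foldl_cons, List.foldl_cons, ih, headD_rskInsert]
  rw [firstRows, rsk, h, partialRows, List.take_of_length_le (by simp)]
  rfl

theorem partialRows_succ (t : Fin n) :
    partialRows σ (t + 1) = firstRowInsert (partialRows σ t) (σ t) t := by
  rw [partialRows, List.take_add_one, List.foldl_append, ← partialRows]
  simp

/-- Inserting `σ t` bumps `y` from the first row. -/
def Bumps (t y : Fin n) : Prop := (rowInsert (σ t) (partialRows σ t).1).2 = some (y : ℕ)

theorem Bumps.right_unique {σ : Equiv.Perm (Fin n)} {t y z : Fin n} (h : Bumps σ t y)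
    (h' : Bumps σ t z) : y = z :=
  Fin.ext (Option.some_injective _ (h.symm.trans h'))

/-- Loop invariant: the first row of `P` is increasing and holds the inserted values not yet bumped;
that of `Q` records the insertions that bumped nothing. The last clause ensures that a freshly
inserted value has not been bumped before. -/
theorem partialRows_spec {k : ℕ} (hk : k ≤ n) :
    (partialRows σ k).1.Pairwise (· < ·) ∧
      (∀ z ∈ (partialRows σ k).1, z < n) ∧
      (∀ z : Fin n, (z : ℕ) ∈ (partialRows σ k).1 ↔
        (σ.symm z : ℕ) < k ∧ ∀ t : Fin n, (t : ℕ) < k → ¬ Bumps σ t z) ∧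
      (∀ t : Fin n, (t : ℕ) ∈ (partialRows σ k).2 ↔ (t : ℕ) < k ∧ ∀ y, ¬ Bumps σ t y) ∧
      ∀ t z : Fin n, (t : ℕ) < k → Bumps σ t z → σ.symm z < t := by
  induction k with
  | zero => simp [partialRows]
  | succ k ih =>
    obtain ⟨h1, h2, h3, h4, h0⟩ := ih (by omega)
    have hσ : ((σ ⟨k, hk⟩ : Fin n) : ℕ) ∉ (partialRows σ k).1 := by
      rw [h3]
      simp
    have hs := partialRows_succ σ ⟨k, hk⟩
    simp only [firstRowInsert] at hs
    have hlt : ∀ t : Fin n, (t : ℕ) < k + 1 ↔ (t : ℕ) < k ∨ t = ⟨k, hk⟩ := by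
      intro t
      rw [Fin.ext_iff]
      exact Nat.lt_succ_iff_lt_or_eq
    have hsymm : ∀ z : Fin n, (σ.symm z : ℕ) < k + 1 ↔ (σ.symm z : ℕ) < k ∨ z = σ ⟨k, hk⟩ := by
      intro z
      rw [hlt, Equiv.symm_apply_eq]
    have hfresh : ∀ t : Fin n, (t : ℕ) < k → ¬ Bumps σ t (σ ⟨k, hk⟩) := by
      intro t ht hB
      have := h0 t _ ht hB
      rw [σ.symm_apply_apply, Fin.lt_def] at this
      exact absurd this (by simpa using ht.le)
    rw [hs]
    rcases hb : (rowInsert (σ ⟨k, hk⟩) (partialRows σ k).1).2 with _ | y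
    · obtain ⟨h5, h6⟩ := rowInsert_none hb
      have hnb : ∀ y, ¬ Bumps σ ⟨k, hk⟩ y := by
        intro y hy
        rw [Bumps, hb] at hy
        cases hy
      simp only [h6, if_true, List.mem_append, List.mem_singleton]
      refine ⟨?_, ?_, ?_, ?_, ?_⟩
      · rw [List.pairwise_append]
        refine ⟨h1, by simp, ?_⟩
        intro a ha b hb'
        rw [List.mem_singleton] at hb'
        subst hb'
        have := h5 a ha
        have : a ≠ σ ⟨k, hk⟩ := fun e => hσ (e ▸ ha)
        omega
      · rintro z (hz | rfl)
        · exact h2 z hz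
        · exact Fin.is_lt _
      · intro z
        rw [h3, hsymm, Fin.val_inj]
        simp only [hlt]
        constructor
        · rintro (⟨ha, hb'⟩ | rfl)
          · refine ⟨Or.inl ha, ?_⟩
            rintro t (ht | rfl)
            · exact hb' t ht
            · exact hnb z
          · refine ⟨Or.inr rfl, ?_⟩
            rintro t (ht | rfl)
            · exact hfresh t ht
            · exact hnb _
        · rintro ⟨ha | rfl, hb'⟩
          · exact Or.inl ⟨ha, fun t ht => hb' t (Or.inl ht)⟩
          · exact Or.inr rfl
      · intro t
        have ht : (t : ℕ) = k ↔ t = ⟨k, hk⟩ := by rw [Fin.ext_iff]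
        rw [h4, hlt, ht]
        constructor
        · rintro (h | rfl)
          · exact ⟨Or.inl h.1, h.2⟩
          · exact ⟨Or.inr rfl, hnb⟩
        · rintro ⟨h | rfl, h'⟩
          · exact Or.inl ⟨h, h'⟩
          · exact Or.inr rfl
      · intro t z ht hB
        rcases (hlt t).1 ht with ht | rfl
        · exact h0 t z ht hB
        · exact absurd hB (hnb z)
    · obtain ⟨h5, -, -, h6, h7⟩ := rowInsert_some h1 hσ hb
      obtain ⟨y, rfl⟩ : ∃ y' : Fin n, (y' : ℕ) = y := ⟨⟨y, h2 y h5⟩, rfl⟩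
      have hB : Bumps σ ⟨k, hk⟩ y := hb
      have hB' : ∀ z, Bumps σ ⟨k, hk⟩ z → z = y := fun z hz => hz.right_unique hB
      simp only [reduceCtorEq, if_false]
      refine ⟨h7, ?_, ?_, ?_, ?_⟩
      · intro z hz
        rcases (h6 z).1 hz with rfl | hz
        · exact Fin.is_lt _
        · exact h2 z hz.1
      · intro z
        rw [h6, h3, hsymm, Ne, Fin.val_inj, Fin.val_inj]
        simp only [hlt]
        constructor
        · rintro (rfl | ⟨⟨ha, hb'⟩, hc⟩)
          · refine ⟨Or.inr rfl, ?_⟩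
            rintro t (ht | rfl) hBt
            · exact hfresh t ht hBt
            · exact hσ (hB' _ hBt ▸ h5)
          · refine ⟨Or.inl ha, ?_⟩
            rintro t (ht | rfl)
            · exact hb' t ht
            · exact fun hBt => hc (hB' z hBt)
        · rintro ⟨ha | rfl, hb'⟩
          · refine Or.inr ⟨⟨ha, fun t ht => hb' t (Or.inl ht)⟩, ?_⟩
            rintro rfl
            exact hb' _ (Or.inr rfl) hB
          · exact Or.inl rfl
      · intro t
        rw [h4, hlt]
        constructor
        · exact fun h => ⟨Or.inl h.1, h.2⟩
        · rintro ⟨h | rfl, h'⟩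
          · exact ⟨h, h'⟩
          · exact absurd hB (h' y)
      · intro t z ht hBt
        rcases (hlt t).1 ht with ht | rfl
        · exact h0 t z ht hBt
        · rw [hB' z hBt]
          exact ((h3 y).1 h5).1

variable {σ}

theorem apply_notMem_partialRows (t : Fin n) : ((σ t : Fin n) : ℕ) ∉ (partialRows σ t).1 := by
  rw [(partialRows_spec σ t.2.le).2.2.1]
  simp

theorem Bumps.seen {t y : Fin n} (h : Bumps σ t y) : σ.symm y < t :=
  (partialRows_spec σ le_rfl).2.2.2.2 t y t.2 h

theorem Bumps.lt {t y : Fin n} (h : Bumps σ t y) : σ t < y :=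
  (rowInsert_some (partialRows_spec σ t.2.le).1 (apply_notMem_partialRows t) h).2.1

theorem Bumps.left_unique {s t y : Fin n} (h : Bumps σ s y) (h' : Bumps σ t y) : s = t := by
  have key : ∀ {s t : Fin n}, Bumps σ s y → Bumps σ t y → ¬ s < t := by
    intro s t h h' hst
    have := (rowInsert_some (partialRows_spec σ t.2.le).1 (apply_notMem_partialRows t) h').1
    exact (((partialRows_spec σ t.2.le).2.2.1 y).1 this).2 s hst h
  exact le_antisymm (not_lt.1 (key h' h)) (not_lt.1 (key h h'))

/-- Insertion bumps the least larger entry, so a better candidate already inserted must have left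
the row. -/
theorem Bumps.min {t y z : Fin n} (h : Bumps σ t y) (h1 : σ t < z) (h2 : z < y)
    (h3 : σ.symm z < t) : ∃ s < t, Bumps σ s z := by
  by_contra! hne
  have hz : (z : ℕ) ∈ (partialRows σ t).1 := ((partialRows_spec σ t.2.le).2.2.1 z).2 ⟨h3, hne⟩
  exact ((rowInsert_some (partialRows_spec σ t.2.le).1 (apply_notMem_partialRows t) h).2.2.1
    z hz h1).not_gt h2

theorem exists_bumps_of_not_bumps {t z : Fin n} (h : ∀ y, ¬ Bumps σ t y) (h1 : σ t < z)
    (h3 : σ.symm z < t) : ∃ s < t, Bumps σ s z := by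
  by_contra! hne
  have hz : (z : ℕ) ∈ (partialRows σ t).1 := ((partialRows_spec σ t.2.le).2.2.1 z).2 ⟨h3, hne⟩
  rcases hb : (rowInsert (σ t) (partialRows σ t).1).2 with _ | y
  · exact (rowInsert_none hb).1 z hz h1
  · have hy := (rowInsert_some (partialRows_spec σ t.2.le).1 (apply_notMem_partialRows t) hb).1
    exact h ⟨y, (partialRows_spec σ t.2.le).2.1 y hy⟩ hb

theorem mem_firstRows_fst (z : Fin n) :
    (z : ℕ) ∈ (firstRows σ).1 ↔ ∀ t, ¬ Bumps σ t z := by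
  rw [firstRows_eq, (partialRows_spec σ le_rfl).2.2.1]
  simp

theorem mem_firstRows_snd (t : Fin n) :
    (t : ℕ) ∈ (firstRows σ).2 ↔ ∀ y, ¬ Bumps σ t y := by
  rw [firstRows_eq, (partialRows_spec σ le_rfl).2.2.2.1]
  simp

end Insertion

/-! ### Heights of the two halves of the path and their common floor -/

section Heights

variable {n : ℕ} (σ : Equiv.Perm (Fin n))

instance : DecidableRel (Bumps σ) := fun _ _ => inferInstanceAs (Decidable (_ = _))

/-- The value at position `t` is bumped from the first row at some time. -/
def IsBumped (t : Fin n) : Prop := ∃ s, Bumps σ s (σ t)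

/-- Inserting the value at position `t` bumps an entry of the first row. -/
def IsBumper (t : Fin n) : Prop := ∃ y, Bumps σ t y

instance : DecidablePred (IsBumped σ) := fun t => inferInstanceAs (Decidable (∃ s, Bumps σ s (σ t)))

instance : DecidablePred (IsBumper σ) := fun t => inferInstanceAs (Decidable (∃ y, Bumps σ t y))

/-- The height of `psi σ` after `j` steps. -/
def heightL (j : ℕ) : ℤ := j - 2 * #{t : Fin n | IsBumped σ t ∧ (σ t : ℕ) < j}

/-- The height of `psi σ` before the last `j` steps. -/
def heightR (j : ℕ) : ℤ := j - 2 * #{t : Fin n | IsBumper σ t ∧ (t : ℕ) < j}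

/-- The least height of `psi σ` after `j` steps and before the last `j` steps. -/
def floorHeight (j : ℕ) : ℤ :=
  #{t : Fin n | t < σ t ∧ ¬ IsBumped σ t ∧ (σ t : ℕ) < j} +
    #{t : Fin n | ¬ t < σ t ∧ ¬ IsBumper σ t ∧ (t : ℕ) < j}

variable {σ}

/-- A bumped value and its bumper form an inversion. -/
theorem IsBumped.exc (h : Avoids p321 σ) {t : Fin n} (ht : IsBumped σ t) : t < σ t := by
  obtain ⟨s, hs⟩ := ht
  exact h.inversion_left (by simpa using hs.seen) hs.lt

theorem IsBumper.lt (h : Avoids p321 σ) {t : Fin n} (ht : IsBumper σ t) : σ t < t := by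
  obtain ⟨y, hy⟩ := ht
  exact h.inversion_right hy.seen (by simpa using hy.lt)

/-- Each bumped value is matched with its bumper, whose value is smaller. -/
theorem card_bumped_le (j : ℕ) : #{t : Fin n | IsBumped σ t ∧ (σ t : ℕ) < j} ≤
    #{t : Fin n | IsBumper σ t ∧ (σ t : ℕ) < j} := by
  refine card_le_card_of_forall_subsingleton (fun t s => Bumps σ s (σ t)) ?_ ?_
  · intro t ht
    simp only [mem_filter, mem_univ, true_and] at ht ⊢
    obtain ⟨⟨s, hs⟩, hj⟩ := ht
    exact ⟨s, ⟨⟨_, hs⟩, (Fin.lt_def.1 hs.lt).trans hj⟩, hs⟩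
  · intro s _ t ht t' ht'
    exact σ.injective (ht.2.right_unique ht'.2)

theorem card_bumper_le (j : ℕ) : #{t : Fin n | IsBumper σ t ∧ (t : ℕ) < j} ≤
    #{t : Fin n | IsBumped σ t ∧ (t : ℕ) < j} := by
  refine card_le_card_of_forall_subsingleton (fun s t => Bumps σ s (σ t)) ?_ ?_
  · intro t ht
    simp only [mem_filter, mem_univ, true_and] at ht ⊢
    obtain ⟨⟨y, hy⟩, hj⟩ := ht
    refine ⟨σ.symm y, ⟨⟨t, by simpa using hy⟩, (Fin.lt_def.1 hy.seen).trans hj⟩, by simpa using hy⟩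
  · intro s _ t ht t' ht'
    exact ht.2.left_unique ht'.2

theorem card_bumped_eq_card_bumper :
    #{t : Fin n | IsBumped σ t} = #{t : Fin n | IsBumper σ t} := by
  have h1 := card_bumped_le (σ := σ) n
  have h2 := card_bumper_le (σ := σ) n
  simp only [Fin.is_lt, and_true] at h1 h2
  exact le_antisymm h1 h2

/-- The values below `j` are classified by type and bumping. The two parts of the excess are bumpers
whose bumped value is not yet below `j`, and non-bumping downward arcs over the gap. -/
theorem heightL_sub_floorHeight (h : Avoids p321 σ) {j : ℕ} (hj : j ≤ n) :
    heightL σ j - floorHeight σ j =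
      #{t : Fin n | IsBumper σ t ∧ (σ t : ℕ) < j} - #{t : Fin n | IsBumped σ t ∧ (σ t : ℕ) < j} +
      #{t : Fin n | ¬ IsBumper σ t ∧ ¬ t < σ t ∧ (σ t : ℕ) < j ∧ j ≤ t} := by
  have key : #{t : Fin n | (σ t : ℕ) < j} = #{t : Fin n | IsBumped σ t ∧ (σ t : ℕ) < j} +
      #{t : Fin n | t < σ t ∧ ¬ IsBumped σ t ∧ (σ t : ℕ) < j} +
      #{t : Fin n | ¬ t < σ t ∧ ¬ IsBumper σ t ∧ (t : ℕ) < j} +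
      #{t : Fin n | IsBumper σ t ∧ (σ t : ℕ) < j} +
      #{t : Fin n | ¬ IsBumper σ t ∧ ¬ t < σ t ∧ (σ t : ℕ) < j ∧ j ≤ t} := by
    simp only [card_filter, ← sum_add_distrib]
    refine sum_congr rfl fun t _ => ?_
    have h1 : IsBumped σ t → t < σ t := fun ht => ht.exc h
    have h2 : IsBumper σ t → σ t < t := fun ht => ht.lt h
    rw [Fin.lt_def] at *
    split_ifs <;> first | omega | grind
  rw [card_lt_perm, card_fin_lt hj] at key
  unfold heightL floorHeight
  omega

theorem heightR_sub_floorHeight (h : Avoids p321 σ) {j : ℕ} (hj : j ≤ n) :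
    heightR σ j - floorHeight σ j =
      #{t : Fin n | IsBumped σ t ∧ (t : ℕ) < j} - #{t : Fin n | IsBumper σ t ∧ (t : ℕ) < j} +
      #{t : Fin n | t < σ t ∧ ¬ IsBumped σ t ∧ (t : ℕ) < j ∧ j ≤ σ t} := by
  have key : #{t : Fin n | (t : ℕ) < j} = #{t : Fin n | IsBumper σ t ∧ (t : ℕ) < j} +
      #{t : Fin n | t < σ t ∧ ¬ IsBumped σ t ∧ (σ t : ℕ) < j} +
      #{t : Fin n | ¬ t < σ t ∧ ¬ IsBumper σ t ∧ (t : ℕ) < j} +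
      #{t : Fin n | IsBumped σ t ∧ (t : ℕ) < j} +
      #{t : Fin n | t < σ t ∧ ¬ IsBumped σ t ∧ (t : ℕ) < j ∧ j ≤ σ t} := by
    simp only [card_filter, ← sum_add_distrib]
    refine sum_congr rfl fun t _ => ?_
    have h1 : IsBumped σ t → t < σ t := fun ht => ht.exc h
    have h2 : IsBumper σ t → σ t < t := fun ht => ht.lt h
    rw [Fin.lt_def] at *
    split_ifs <;> first | omega | grind
  rw [card_fin_lt hj] at key
  unfold heightR floorHeight
  omega

theorem floorHeight_le_heightL (h : Avoids p321 σ) {j : ℕ} (hj : j ≤ n) :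
    floorHeight σ j ≤ heightL σ j := by
  have := heightL_sub_floorHeight h hj
  have := card_bumped_le (σ := σ) j
  omega

theorem floorHeight_le_heightR (h : Avoids p321 σ) {j : ℕ} (hj : j ≤ n) :
    floorHeight σ j ≤ heightR σ j := by
  have := heightR_sub_floorHeight h hj
  have := card_bumper_le (σ := σ) j
  omega

theorem floorHeight_lt_heightR (h : Avoids p321 σ) {t : Fin n} (ht : t < σ t)
    (hb : ¬ IsBumped σ t) : floorHeight σ (σ t) < heightR σ (σ t) := by
  have := heightR_sub_floorHeight h (σ t).2.le
  have := card_bumper_le (σ := σ) (σ t)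
  have : 0 < #{s : Fin n | s < σ s ∧ ¬ IsBumped σ s ∧ (s : ℕ) < σ t ∧ (σ t : ℕ) ≤ σ s} :=
    card_pos.2 ⟨t, by simp [ht, hb]⟩
  omega

/-- Both parts of the excess vanish because `σ t` stays in the row forever: a later insertion of a
smaller value must bump something, and cannot bump anything above `σ t`. -/
theorem heightL_eq_floorHeight (h : Avoids p321 σ) {t : Fin n} (ht : t < σ t)
    (hb : ¬ IsBumped σ t) : heightL σ (σ t) = floorHeight σ (σ t) := by
  have h1 := heightL_sub_floorHeight h (σ t).2.le
  have h2 := card_bumped_le (σ := σ) (σ t)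
  have h3 : #{s : Fin n | IsBumper σ s ∧ (σ s : ℕ) < σ t} ≤
      #{s : Fin n | IsBumped σ s ∧ (σ s : ℕ) < σ t} := by
    refine card_le_card_of_forall_subsingleton (fun s r => Bumps σ s (σ r)) ?_ ?_
    · intro s hs
      simp only [mem_filter, mem_univ, true_and] at hs ⊢
      obtain ⟨⟨y, hy⟩, hj⟩ := hs
      refine ⟨σ.symm y, ⟨⟨s, by simpa using hy⟩, ?_⟩, by simpa using hy⟩
      rw [σ.apply_symm_apply, ← Fin.lt_def]
      refine lt_of_le_of_ne (not_lt.1 fun hlt => ?_) fun e => hb ⟨s, e ▸ hy⟩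
      have hts : t < σ.symm y := by
        refine h.lt_of_apply_lt (iff_of_true ht ?_) (by simpa using hlt)
        refine IsBumped.exc h ⟨s, by simpa using hy⟩
      obtain ⟨r, _, hr⟩ := hy.min hj hlt (by simpa using hts.trans hy.seen)
      exact hb ⟨r, hr⟩
    · intro r _ s hs s' hs'
      exact hs.2.left_unique hs'.2
  have h4 : #{s : Fin n | ¬ IsBumper σ s ∧ ¬ s < σ s ∧ (σ s : ℕ) < σ t ∧ (σ t : ℕ) ≤ s} = 0 := by
    rw [card_eq_zero, filter_eq_empty_iff]
    rintro s - ⟨ha, -, hc, hd⟩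
    have hts : t < s := lt_of_lt_of_le ht hd
    obtain ⟨r, _, hr⟩ := exists_bumps_of_not_bumps (z := σ t) (fun y hy => ha ⟨y, hy⟩) hc
      (by simpa using hts)
    exact hb ⟨r, hr⟩
  omega

/-- Inserting `σ t` bumps nothing, so every larger value seen before is already bumped. A smaller
one bumped after `t` would put a still smaller value after `t`, making `t` an excedance. -/
theorem heightR_eq_floorHeight (h : Avoids p321 σ) {t : Fin n} (ht : ¬ t < σ t)
    (hb : ¬ IsBumper σ t) : heightR σ t = floorHeight σ t := by
  have h1 := heightR_sub_floorHeight h t.2.le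
  have h2 := card_bumper_le (σ := σ) t
  have hnb : ∀ y, ¬ Bumps σ t y := fun y hy => hb ⟨y, hy⟩
  have h3 : #{s : Fin n | IsBumped σ s ∧ (s : ℕ) < t} ≤
      #{s : Fin n | IsBumper σ s ∧ (s : ℕ) < t} := by
    refine card_le_card_of_forall_subsingleton (fun s r => Bumps σ r (σ s)) ?_ ?_
    · intro s hs
      simp only [mem_filter, mem_univ, true_and] at hs ⊢
      obtain ⟨⟨r, hr⟩, hj⟩ := hs
      suffices r < t from ⟨r, ⟨⟨_, hr⟩, this⟩, hr⟩
      refine lt_of_le_of_ne (not_lt.1 fun hlt => ?_) fun e => hnb _ (e ▸ hr)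
      by_cases hst : σ t < σ s
      · obtain ⟨r', hr', hB⟩ := exists_bumps_of_not_bumps (z := σ s) hnb hst (by simpa using hj)
        exact (hr'.trans hlt).ne (hB.left_unique hr)
      · have hst' : σ s < σ t :=
          lt_of_le_of_ne (not_lt.1 hst) fun e => (Fin.ne_of_lt hj) (σ.injective e)
        exact ht (h.inversion_left hlt (hr.lt.trans hst'))
    · intro r _ s hs s' hs'
      exact σ.injective (hs.2.right_unique hs'.2)
  have h4 : #{s : Fin n | s < σ s ∧ ¬ IsBumped σ s ∧ (s : ℕ) < t ∧ (t : ℕ) ≤ σ s} = 0 := by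
    rw [card_eq_zero, filter_eq_empty_iff]
    rintro s - ⟨ha, hb', hc, hd⟩
    have hlt : σ t < σ s := lt_of_le_of_ne ((not_lt.1 ht).trans hd)
      fun e => (Fin.ne_of_lt hc) (σ.injective e).symm
    obtain ⟨r, _, hr⟩ := exists_bumps_of_not_bumps (z := σ s) hnb hlt (by simpa using hc)
    exact hb' ⟨r, hr⟩
  omega

theorem heightR_top : heightR σ n = heightL σ n := by
  simp [heightR, heightL, card_bumped_eq_card_bumper]

theorem heightL_top (h : Avoids p321 σ) : heightL σ n = floorHeight σ n := by
  have h1 := heightL_sub_floorHeight h le_rfl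
  have h4 : #{s : Fin n | ¬ IsBumper σ s ∧ ¬ s < σ s ∧ (σ s : ℕ) < n ∧ n ≤ s} = 0 := by
    rw [card_eq_zero, filter_eq_empty_iff]
    rintro s - ⟨-, -, -, hd⟩
    omega
  rw [h4] at h1
  simp only [Fin.is_lt, and_true, card_bumped_eq_card_bumper] at h1
  omega

/-- The two possible causes of a rise exclude each other at the same `j`: one forces the floor
strictly below `heightR`, the other forces equality. -/
theorem floorHeight_succ_le {j : ℕ} (h : Avoids p321 σ) :
    floorHeight σ (j + 1) ≤ floorHeight σ j + 1 ∧
      (floorHeight σ j < floorHeight σ (j + 1) →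
        (∃ t, t < σ t ∧ (σ t : ℕ) = j ∧ ¬ IsBumped σ t) ∨
        ∃ t, ¬ t < σ t ∧ (t : ℕ) = j ∧ ¬ IsBumper σ t) := by
  have h1 : #{t : Fin n | t < σ t ∧ ¬ IsBumped σ t ∧ (σ t : ℕ) < j + 1} =
      #{t : Fin n | t < σ t ∧ ¬ IsBumped σ t ∧ (σ t : ℕ) < j} +
      #{t : Fin n | t < σ t ∧ (σ t : ℕ) = j ∧ ¬ IsBumped σ t} := by
    simp only [card_filter, ← sum_add_distrib]
    refine sum_congr rfl fun t _ => ?_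
    split_ifs <;> first | omega | grind
  have h2 : #{t : Fin n | ¬ t < σ t ∧ ¬ IsBumper σ t ∧ (t : ℕ) < j + 1} =
      #{t : Fin n | ¬ t < σ t ∧ ¬ IsBumper σ t ∧ (t : ℕ) < j} +
      #{t : Fin n | ¬ t < σ t ∧ (t : ℕ) = j ∧ ¬ IsBumper σ t} := by
    simp only [card_filter, ← sum_add_distrib]
    refine sum_congr rfl fun t _ => ?_
    split_ifs <;> first | omega | grind
  have h3 : #{t : Fin n | t < σ t ∧ (σ t : ℕ) = j ∧ ¬ IsBumped σ t} ≤ 1 := by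
    refine card_le_one.2 fun a ha b hb => ?_
    simp only [mem_filter, mem_univ, true_and] at ha hb
    exact σ.injective (Fin.ext (ha.2.1.trans hb.2.1.symm))
  have h4 : #{t : Fin n | ¬ t < σ t ∧ (t : ℕ) = j ∧ ¬ IsBumper σ t} ≤ 1 := by
    refine card_le_one.2 fun a ha b hb => ?_
    simp only [mem_filter, mem_univ, true_and] at ha hb
    exact Fin.ext (ha.2.1.trans hb.2.1.symm)
  have h5 : ¬ (0 < #{t : Fin n | t < σ t ∧ (σ t : ℕ) = j ∧ ¬ IsBumped σ t} ∧
      0 < #{t : Fin n | ¬ t < σ t ∧ (t : ℕ) = j ∧ ¬ IsBumper σ t}) := by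
    rintro ⟨ha, hb⟩
    obtain ⟨a, ha⟩ := card_pos.1 ha
    obtain ⟨b, hb⟩ := card_pos.1 hb
    simp only [mem_filter, mem_univ, true_and] at ha hb
    have e1 := floorHeight_lt_heightR h ha.1 ha.2.2
    have e2 := heightR_eq_floorHeight h hb.1 hb.2.2
    rw [ha.2.1] at e1
    rw [hb.2.1] at e2
    omega
  unfold floorHeight
  refine ⟨by omega, fun hlt => ?_⟩
  have : 0 < #{t : Fin n | t < σ t ∧ (σ t : ℕ) = j ∧ ¬ IsBumped σ t} ∨
      0 < #{t : Fin n | ¬ t < σ t ∧ (t : ℕ) = j ∧ ¬ IsBumper σ t} := by omega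
  refine this.imp (fun hp => ?_) fun hp => ?_ <;>
  · obtain ⟨a, ha⟩ := card_pos.1 hp
    exact ⟨a, by simpa using ha⟩

/-- Between any two numbers of steps, the floor passes through each intermediate height at a step
that starts or ends on the floor. -/
theorem exists_floor_step (h : Avoids p321 σ) {j : ℕ} {m : ℤ} (hj : j ≤ n)
    (h1 : floorHeight σ j ≤ m) (h2 : m < floorHeight σ n) :
    ∃ k, j ≤ k ∧ k < n ∧ floorHeight σ k = m ∧
      ((heightL σ k = m ∧ ∃ t, t < σ t ∧ (σ t : ℕ) = k ∧ ¬ IsBumped σ t) ∨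
        heightR σ k = m ∧ ∃ t, ¬ t < σ t ∧ (t : ℕ) = k ∧ ¬ IsBumper σ t) := by
  induction hj using Nat.decreasingInduction with
  | self => omega
  | of_succ j hj ih =>
    by_cases hm : floorHeight σ (j + 1) ≤ m
    · obtain ⟨k, hk, hk'⟩ := ih hm
      exact ⟨k, by omega, hk'⟩
    · obtain ⟨h3, h4⟩ := floorHeight_succ_le (j := j) h
      have hjm : floorHeight σ j = m := by omega
      refine ⟨j, le_rfl, hj, hjm, ?_⟩
      refine (h4 (by omega)).imp ?_ ?_
      · rintro ⟨t, ht, rfl, hb⟩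
        exact ⟨(heightL_eq_floorHeight h ht hb).trans hjm, t, ht, rfl, hb⟩
      · rintro ⟨t, ht, rfl, hb⟩
        exact ⟨(heightR_eq_floorHeight h ht hb).trans hjm, t, ht, rfl, hb⟩

end Heights

/-! ### Tunnels of Dyck paths and the map `Φ⁻¹` -/

section Tunnels

/-- The height of the path `w` after `k` steps. -/
def height (w : List DyckStep) (k : ℕ) : ℤ := (w.take k).count U - (w.take k).count D

theorem count_U_add_count_D (w : List DyckStep) : w.count U + w.count D = w.length := by
  induction w with
  | nil => rfl
  | cons s w ih => cases s <;> simp <;> omega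

theorem count_take_mono (w : List DyckStep) (s : DyckStep) {i j : ℕ} (h : i ≤ j) :
    (w.take i).count s ≤ (w.take j).count s :=
  (List.take_sublist_take_left h).count_le s

theorem count_take_succ_self {w : List DyckStep} {s : DyckStep} {k : ℕ} (h : w[k]? = some s) :
    (w.take (k + 1)).count s = (w.take k).count s + 1 := by
  simp [List.take_add_one, h]

theorem count_take_succ_of_ne {w : List DyckStep} {s s' : DyckStep} {k : ℕ} (h : w[k]? = some s)
    (hs : s ≠ s') : (w.take (k + 1)).count s' = (w.take k).count s' := by
  simp [List.take_add_one, h, hs]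

theorem height_succ_U {w : List DyckStep} {k : ℕ} (h : w[k]? = some U) :
    height w (k + 1) = height w k + 1 := by
  rw [height, height, count_take_succ_self h, count_take_succ_of_ne h (by decide)]
  push_cast
  ring

theorem height_succ_D {w : List DyckStep} {k : ℕ} (h : w[k]? = some D) :
    height w (k + 1) = height w k - 1 := by
  rw [height, height, count_take_succ_self h, count_take_succ_of_ne h (by decide)]
  push_cast
  ring

theorem getElem?_eq_U_or_D {w : List DyckStep} {k : ℕ} (h : k < w.length) :
    w[k]? = some U ∨ w[k]? = some D := by
  rw [List.getElem?_eq_getElem h]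
  simpa using w[k].dichotomy

theorem count_take_add {w : List DyckStep} {k : ℕ} (h : k ≤ w.length) :
    (w.take k).count U + (w.take k).count D = k := by
  rw [count_U_add_count_D, List.length_take, min_eq_left h]

theorem lt_of_count_take_lt {w : List DyckStep} {s : DyckStep} {i j : ℕ}
    (h : (w.take i).count s < (w.take j).count s) : i < j :=
  not_le.1 fun hji => (count_take_mono w s hji).not_gt h

theorem count_take_lt {w : List DyckStep} {s : DyckStep} {i j : ℕ} (hs : w[i]? = some s)
    (h : i < j) : (w.take i).count s < (w.take j).count s := by
  have := count_take_mono w s (Nat.succ_le_of_lt h)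
  rw [Nat.succ_eq_add_one, count_take_succ_self hs] at this
  omega

theorem eq_of_count_take_eq {w : List DyckStep} {s : DyckStep} {i j : ℕ} (hi : w[i]? = some s)
    (hj : w[j]? = some s) (h : (w.take i).count s = (w.take j).count s) : i = j := by
  rcases lt_trichotomy i j with hlt | rfl | hlt
  · exact absurd h (count_take_lt hi hlt).ne
  · rfl
  · exact absurd h (count_take_lt hj hlt).ne'

theorem exists_count_take_eq {w : List DyckStep} {s : DyckStep} {a : ℕ} (h : a < w.count s) :
    ∃ x, w[x]? = some s ∧ (w.take x).count s = a := by
  have hex : ∃ k, a < (w.take k).count s := ⟨w.length, by simpa using h⟩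
  obtain ⟨k, hk, hmin⟩ : ∃ k, a < (w.take k).count s ∧ ∀ j < k, ¬ a < (w.take j).count s :=
    ⟨Nat.find hex, Nat.find_spec hex, fun j hj => Nat.find_min hex hj⟩
  rcases k with _ | k
  · simp at hk
  have hk' := hmin k (by omega)
  rcases hw : w[k]? with _ | s'
  · simp [List.take_add_one, hw] at hk
    omega
  · by_cases hs : s' = s
    · subst hs
      refine ⟨k, hw, ?_⟩
      rw [count_take_succ_self hw] at hk
      omega
    · rw [count_take_succ_of_ne hw hs] at hk
      omega

/-- A tunnel of `w` from its step number `x` to its step number `y`, counted from `0`. -/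
structure Tunnel (w : List DyckStep) (x y : ℕ) : Prop where
  lt : x < y
  left : w[x]? = some U
  right : w[y]? = some D
  height_eq : height w (y + 1) = height w x
  above : ∀ z, x < z → z ≤ y → height w x < height w z

theorem isTunnel_iff {w : List DyckStep} {a b : ℕ} : IsTunnel w a b ↔
    ∃ x y, Tunnel w x y ∧ (w.take x).count U = a ∧ (w.take y).count D = b := by
  constructor
  · rintro ⟨A, B, C, rfl, rfl, rfl⟩
    have htake : ∀ k, k ≤ B.toList.length →
        (A ++ U :: (B.toList ++ D :: C)).take (A.length + 1 + k) = A ++ U :: B.toList.take k := by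
      intro k hk
      rw [add_assoc, List.take_length_add_append, add_comm 1 k, List.take_succ_cons,
        List.take_append_of_le_length hk]
    have hA : (A ++ U :: (B.toList ++ D :: C)).take A.length = A := by simp
    have hy := htake B.toList.length le_rfl
    rw [List.take_length] at hy
    have hB := B.count_U_eq_count_D
    have hleft : (A ++ U :: (B.toList ++ D :: C))[A.length]? = some U := by simp
    have hright : (A ++ U :: (B.toList ++ D :: C))[A.length + 1 + B.toList.length]? = some D := by
      rw [List.getElem?_append_right (by omega),
        show A.length + 1 + B.toList.length - A.length = B.toList.length + 1 by omega]
      simp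
    refine ⟨A.length, A.length + 1 + B.toList.length, ⟨by omega, hleft, hright, ?_, ?_⟩, ?_, ?_⟩
    · rw [height_succ_D hright, height, height, hy, hA]
      simp only [List.count_append, List.count_cons, hB]
      simp
      ring
    · intro z hxz hzy
      obtain ⟨k, rfl⟩ := Nat.exists_eq_add_of_lt hxz
      have hk := B.count_D_le_count_U k
      rw [show A.length + k + 1 = A.length + 1 + k by ring, height, height, htake k (by omega), hA]
      simp only [List.count_append, List.count_cons]
      simp
      omega
    · rw [hA]
    · rw [hy]
  · rintro ⟨x, y, h, rfl, rfl⟩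
    obtain ⟨m, rfl⟩ := Nat.exists_eq_add_of_lt h.lt
    have hsplit : ∀ k, w.take (x + 1 + k) = w.take x ++ U :: (w.drop (x + 1)).take k := by
      intro k
      rw [List.take_add, List.take_add_one, h.left]
      simp
    have hheight : ∀ k, height w (x + 1 + k) =
        height w x + 1 + ((w.drop (x + 1)).take k).count U -
          ((w.drop (x + 1)).take k).count D := by
      intro k
      rw [height, hsplit, height]
      simp only [List.count_append, List.count_cons]
      simp
      ring
    have hpos : ∀ k ≤ m, ((w.drop (x + 1)).take k).count D ≤ ((w.drop (x + 1)).take k).count U := by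
      intro k hk
      have h1 := h.above (x + 1 + k) (by omega) (by omega)
      rw [hheight] at h1
      omega
    refine ⟨w.take x, ⟨(w.drop (x + 1)).take m, ?_, ?_⟩, w.drop (x + m + 1 + 1), ?_, rfl, ?_⟩
    · have h1 := h.height_eq
      rw [height_succ_D h.right, show x + m + 1 = x + 1 + m by ring, hheight] at h1
      omega
    · intro i
      rw [List.take_take]
      exact hpos _ (min_le_right _ _)
    · have h1 : w.drop (x + m + 1) = D :: w.drop (x + m + 1 + 1) := by
        obtain ⟨hlt, he⟩ := List.getElem?_eq_some_iff.1 h.right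
        rw [List.drop_eq_getElem_cons hlt, he]
      have h2 := hsplit m
      rw [show x + 1 + m = x + m + 1 by ring] at h2
      conv_lhs => rw [← List.take_append_drop (x + m + 1) w]
      rw [h1, h2]
      simp
    · rw [← hsplit, show x + m + 1 = x + 1 + m by ring]

namespace Tunnel

variable {w : List DyckStep} {x y x' y' : ℕ}

theorem right_unique (h : Tunnel w x y) (h' : Tunnel w x y') : y = y' := by
  have key : ∀ {y y'}, Tunnel w x y → Tunnel w x y' → ¬ y < y' := by
    intro y y' h h' hlt
    have h1 := h'.above (y + 1) (by have := h.lt; omega) hlt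
    have h2 := h.height_eq
    omega
  exact le_antisymm (not_lt.1 (key h' h)) (not_lt.1 (key h h'))

theorem left_unique (h : Tunnel w x y) (h' : Tunnel w x' y) : x = x' := by
  have key : ∀ {x x'}, Tunnel w x y → Tunnel w x' y → ¬ x < x' := by
    intro x x' h h' hlt
    have h1 := h.above x' hlt h'.lt.le
    have h2 := h.height_eq
    have h3 := h'.height_eq
    omega
  exact le_antisymm (not_lt.1 (key h' h)) (not_lt.1 (key h h'))

theorem noncrossing (h : Tunnel w x y) (h' : Tunnel w x' y') (hx : x < x') :
    y < x' ∨ y' < y := by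
  by_contra! hc
  rcases hc.2.lt_or_eq with hlt | rfl
  · have h1 := h.above x' hx hc.1
    have h2 := h'.above (y + 1) (by omega) hlt
    have h3 := h.height_eq
    omega
  · exact hx.ne (h.left_unique h')

end Tunnel

/-- The path `w` has `2 * n` steps, never passes below height `0` and ends there. -/
structure IsDyck (n : ℕ) (w : List DyckStep) : Prop where
  length_eq : w.length = 2 * n
  nonneg : ∀ k, 0 ≤ height w k
  height_end : height w (2 * n) = 0

theorem isDyckPath_iff {n : ℕ} {w : List DyckStep} : IsDyckPath n w ↔ IsDyck n w := by
  constructor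
  · rintro ⟨p, rfl, rfl⟩
    have h := p.count_U_eq_count_D
    have h' := count_U_add_count_D p.toList
    have hl : p.toList.length = 2 * p.semilength := by
      rw [DyckWord.semilength]
      omega
    refine ⟨hl, fun k => ?_, ?_⟩
    · have := p.count_D_le_count_U k
      rw [height]
      omega
    · rw [height, ← hl, List.take_length]
      omega
  · intro h
    have h1 := h.height_end
    rw [height, ← h.length_eq, List.take_length] at h1
    refine ⟨⟨w, by omega, fun i => ?_⟩, rfl, ?_⟩
    · have := h.nonneg i
      rw [height] at this
      omega
    · have h2 := count_U_add_count_D w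
      have h3 := h.length_eq
      change w.count U = n
      omega

variable {n : ℕ} {w : List DyckStep}

theorem IsDyck.count_eq (h : IsDyck n w) : w.count U = n ∧ w.count D = n := by
  have h1 := h.height_end
  rw [height, ← h.length_eq, List.take_length] at h1
  have h2 := count_U_add_count_D w
  have h3 := h.length_eq
  omega

/-- The tunnel ends at the first return to the starting height. -/
theorem exists_tunnel_of_height_le {x z : ℕ} (hx : w[x]? = some U) (hxz : x < z)
    (hz : height w z ≤ height w x) (hl : z ≤ w.length) : ∃ y < z, Tunnel w x y := by
  have hex : ∃ k, x < k ∧ height w k ≤ height w x := ⟨z, hxz, hz⟩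
  obtain ⟨k, ⟨hk1, hk2⟩, hle, hmin⟩ : ∃ k, (x < k ∧ height w k ≤ height w x) ∧ k ≤ z ∧
      ∀ j < k, ¬ (x < j ∧ height w j ≤ height w x) :=
    ⟨Nat.find hex, Nat.find_spec hex, Nat.find_min' hex ⟨hxz, hz⟩,
      fun j hj => Nat.find_min hex hj⟩
  obtain ⟨y, rfl⟩ : ∃ y, k = y + 1 := ⟨k - 1, by omega⟩
  have hu := height_succ_U hx
  have hxy : x < y := by
    rcases (Nat.lt_succ_iff.1 hk1).lt_or_eq with hlt | rfl
    · exact hlt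
    · omega
  have hy : height w x < height w y := not_le.1 fun hc => hmin y (by omega) ⟨hxy, hc⟩
  rcases getElem?_eq_U_or_D (w := w) (k := y) (by omega) with hU | hD
  · have := height_succ_U hU
    omega
  · have := height_succ_D hD
    exact ⟨y, by omega, hxy, hx, hD, by omega,
      fun j h1 h2 => not_le.1 fun hc => hmin j (by omega) ⟨h1, hc⟩⟩

theorem IsDyck.exists_tunnel (h : IsDyck n w) {x : ℕ} (hx : w[x]? = some U) :
    ∃ y, Tunnel w x y := by
  obtain ⟨hlt, -⟩ := List.getElem?_eq_some_iff.1 hx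
  obtain ⟨y, -, hy⟩ := exists_tunnel_of_height_le hx hlt
    (by rw [h.length_eq, h.height_end]; exact h.nonneg x) le_rfl
  exact ⟨y, hy⟩

/-- The step numbers `x i` and `y i` of the ends of the tunnel that `Φ⁻¹` makes the entry `i` of
`π`. -/
structure TunnelEnds (w : List DyckStep) (π : Equiv.Perm (Fin n)) (x y : Fin n → ℕ) : Prop where
  tunnel : ∀ i, Tunnel w (x i) (y i)
  count_U : ∀ i, (w.take (x i)).count U = i.rev
  count_D : ∀ i, (w.take (y i)).count D = π i

theorem IsPhiInv.exists_tunnelEnds {π : Equiv.Perm (Fin n)} (h : IsPhiInv w π) :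
    ∃ x y, TunnelEnds w π x y := by
  have h1 : ∀ i : Fin n, ∃ x y, Tunnel w x y ∧ (w.take x).count U = i.rev ∧
      (w.take y).count D = π i := fun i => isTunnel_iff.1 ((h i.rev (π i)).1 (by rw [Fin.rev_rev]))
  choose x y h2 using h1
  exact ⟨x, y, fun i => (h2 i).1, fun i => (h2 i).2.1, fun i => (h2 i).2.2⟩

theorem IsDyck.exists_isPhiInv (h : IsDyck n w) : ∃ π : Equiv.Perm (Fin n), IsPhiInv w π := by
  have h1 : ∀ a : Fin n, ∃ x y, Tunnel w x y ∧ (w.take x).count U = a := by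
    intro a
    obtain ⟨x, hx, hc⟩ := exists_count_take_eq (w := w) (s := U) (a := a)
      (by rw [h.count_eq.1]; exact a.2)
    obtain ⟨y, hy⟩ := h.exists_tunnel hx
    exact ⟨x, y, hy, hc⟩
  choose x y hT hx using h1
  have hlt : ∀ a, (w.take (y a)).count D < n := by
    intro a
    have := count_take_lt (hT a).right (List.getElem?_eq_some_iff.1 (hT a).right).1
    rwa [List.take_length, h.count_eq.2] at this
  let f : Fin n → Fin n := fun a => ⟨(w.take (y a)).count D, hlt a⟩
  have hf : Function.Injective f := by
    intro a b hab
    have hy : y a = y b := eq_of_count_take_eq (hT a).right (hT b).right (Fin.ext_iff.1 hab)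
    have hx' : x a = x b := (hT a).left_unique (hy ▸ hT b)
    exact Fin.ext (by rw [← hx a, ← hx b, hx'])
  refine ⟨Fin.revPerm.trans (Equiv.ofBijective f (Finite.injective_iff_bijective.1 hf)), ?_⟩
  intro a b
  have hfa : (Fin.revPerm.trans (Equiv.ofBijective f (Finite.injective_iff_bijective.1 hf))) a.rev =
      f a := by simp
  rw [hfa, isTunnel_iff]
  constructor
  · rintro rfl
    exact ⟨x a, y a, hT a, hx a, rfl⟩
  · rintro ⟨x', y', hT', hx', hy'⟩
    have e1 : x' = x a := eq_of_count_take_eq hT'.left (hT a).left (hx'.trans (hx a).symm)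
    subst e1
    have e2 := hT'.right_unique (hT a)
    subst e2
    exact Fin.ext hy'

namespace TunnelEnds

variable {π : Equiv.Perm (Fin n)} {x y : Fin n → ℕ}

theorem left_lt_iff (h : TunnelEnds w π x y) {k : ℕ} (i : Fin n) :
    x i < k ↔ (i.rev : ℕ) < (w.take k).count U := by
  rw [← h.count_U]
  exact ⟨count_take_lt (h.tunnel i).left, lt_of_count_take_lt⟩

theorem right_lt_iff (h : TunnelEnds w π x y) {k : ℕ} (i : Fin n) :
    y i < k ↔ (π i : ℕ) < (w.take k).count D := by
  rw [← h.count_D]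
  exact ⟨count_take_lt (h.tunnel i).right, lt_of_count_take_lt⟩

theorem left_lt_left (h : TunnelEnds w π x y) {i j : Fin n} : x i < x j ↔ j < i := by
  rw [h.left_lt_iff, h.count_U, ← Fin.lt_def, Fin.rev_lt_rev]

theorem right_lt_right (h : TunnelEnds w π x y) {i j : Fin n} : y i < y j ↔ π i < π j := by
  rw [h.right_lt_iff, h.count_D, ← Fin.lt_def]

/-- Equal heights at the two ends give `x i + y i = 2 * n - 1 + 2 * (π i - i)` over the integers; a
centred tunnel is a fixed point. -/
theorem lt_apply_iff (h : TunnelEnds w π x y) (i : Fin n) : i < π i ↔ 2 * n ≤ x i + y i := by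
  have h1 := h.count_U i
  have h2 := h.count_D i
  have hT := h.tunnel i
  have h3 := (List.getElem?_eq_some_iff.1 hT.left).1
  have h4 := (List.getElem?_eq_some_iff.1 hT.right).1
  have h5 := count_take_add h3.le
  have h6 := count_take_add h4.le
  have h7 := hT.height_eq
  rw [height_succ_D hT.right, height, height] at h7
  rw [Fin.val_rev] at h1
  rw [Fin.lt_def]
  omega

theorem right_lt (h : TunnelEnds w π x y) (hw : IsDyck n w) (i : Fin n) : y i < 2 * n := by
  rw [← hw.length_eq]
  exact (List.getElem?_eq_some_iff.1 (h.tunnel i).right).1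

theorem card_left_lt (h : TunnelEnds w π x y) (hw : IsDyck n w) (k : ℕ) :
    #{i | x i < k} = (w.take k).count U := by
  have hk : (w.take k).count U ≤ n := by
    rw [← hw.count_eq.1]
    exact (List.take_sublist k w).count_le U
  simp only [h.left_lt_iff]
  exact (card_lt_perm Fin.revPerm _).trans (card_fin_lt hk)

theorem card_right_lt (h : TunnelEnds w π x y) (hw : IsDyck n w) (k : ℕ) :
    #{i | y i < k} = (w.take k).count D := by
  have hk : (w.take k).count D ≤ n := by
    rw [← hw.count_eq.2]
    exact (List.take_sublist k w).count_le D
  simp only [h.right_lt_iff]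
  rw [card_lt_perm, card_fin_lt hk]

theorem card_add (h : TunnelEnds w π x y) (hw : IsDyck n w) {k : ℕ} (hk : k ≤ 2 * n) :
    #{i | x i < k} + #{i | y i < k} = k := by
  rw [h.card_left_lt hw, h.card_right_lt hw, count_take_add (by rwa [hw.length_eq])]

theorem exists_left (h : TunnelEnds w π x y) (hw : IsDyck n w) {k : ℕ} (hk : w[k]? = some U) :
    ∃ i, x i = k := by
  have hlt := count_take_lt hk (List.getElem?_eq_some_iff.1 hk).1
  rw [List.take_length, hw.count_eq.1] at hlt
  refine ⟨Fin.rev ⟨_, hlt⟩, eq_of_count_take_eq (h.tunnel _).left hk ?_⟩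
  rw [h.count_U, Fin.rev_rev]

theorem exists_right (h : TunnelEnds w π x y) (hw : IsDyck n w) {k : ℕ} (hk : w[k]? = some D) :
    ∃ i, y i = k := by
  have hlt := count_take_lt hk (List.getElem?_eq_some_iff.1 hk).1
  rw [List.take_length, hw.count_eq.2] at hlt
  refine ⟨π.symm ⟨_, hlt⟩, eq_of_count_take_eq (h.tunnel _).right hk ?_⟩
  rw [h.count_D, π.apply_symm_apply]

/-- Larger indices open further left, so a 132 would force two tunnels to cross. -/
theorem avoids (h : TunnelEnds w π x y) : Avoids p132 π := by
  rintro ⟨f, hf⟩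
  have h1 : f 0 < f 1 := f.strictMono (by decide)
  have h2 : f 1 < f 2 := f.strictMono (by decide)
  have h3 : π (f 0) < π (f 2) := (hf 0 2).2 (by decide)
  have h4 : π (f 2) < π (f 1) := (hf 2 1).2 (by decide)
  rw [← h.left_lt_left] at h1 h2
  rw [← h.right_lt_right] at h3 h4
  have h5 := (h.tunnel (f 0)).lt
  have := (h.tunnel (f 2)).noncrossing (h.tunnel (f 1)) h2
  omega

end TunnelEnds

/-- The permutation `Φ⁻¹(w)` determines `w`. -/
theorem IsPhiInv.path_unique {π : Equiv.Perm (Fin n)} {w' : List DyckStep} (hw : IsDyck n w)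
    (hw' : IsDyck n w') (h : IsPhiInv w π) (h' : IsPhiInv w' π) : w = w' := by
  -- At the first difference, `w'` closes a tunnel `i` that is still open in `w`, where a tunnel `j`
  -- opens inside it. Then `π j < π i`, so `j` would have closed earlier in `w'`, hence earlier in
  -- `w`.
  have key : ∀ {w w' : List DyckStep}, IsDyck n w → IsDyck n w' → IsPhiInv w π →
      IsPhiInv w' π → ∀ k, w.take k = w'.take k → w[k]? = some U → w'[k]? = some D → False := by
    intro w w' hw hw' h h' k hk hU hD
    obtain ⟨x, y, hxy⟩ := h.exists_tunnelEnds
    obtain ⟨x', y', hxy'⟩ := h'.exists_tunnelEnds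
    obtain ⟨i, hi⟩ := hxy'.exists_right hw' hD
    obtain ⟨j, hj⟩ := hxy.exists_left hw hU
    have h1 : x' i < k := hi ▸ (hxy'.tunnel i).lt
    rw [hxy'.left_lt_iff, ← hk, ← hxy.left_lt_iff] at h1
    have h2 : ¬ y i < k := by
      rw [hxy.right_lt_iff, hk, ← hxy'.right_lt_iff]
      omega
    have h3 : x j < y j := (hxy.tunnel j).lt
    have h4 : ¬ y j < y i := by
      rw [hxy.right_lt_right, ← hxy'.right_lt_right, hi, hxy'.right_lt_iff, ← hk,
        ← hxy.right_lt_iff]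
      omega
    have h5 : k ≠ y i := by
      rintro rfl
      rw [(hxy.tunnel i).right] at hU
      cases hU
    have := (hxy.tunnel i).noncrossing (hxy.tunnel j) (by omega)
    omega
  have hk : ∀ k, w.take k = w'.take k := by
    intro k
    induction k with
    | zero => simp
    | succ k ih =>
      rw [List.take_add_one, List.take_add_one, ih]
      congr 2
      by_cases hk : k < 2 * n
      · rcases getElem?_eq_U_or_D (hw.length_eq ▸ hk) with h1 | h1 <;>
        rcases getElem?_eq_U_or_D (hw'.length_eq ▸ hk) with h2 | h2
        · rw [h1, h2]
        · exact (key hw hw' h h' k ih h1 h2).elim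
        · exact (key hw' hw h' h k ih.symm h2 h1).elim
        · rw [h1, h2]
      · rw [List.getElem?_eq_none (by rw [hw.length_eq]; omega),
          List.getElem?_eq_none (by rw [hw'.length_eq]; omega)]
  have := hk (2 * n)
  rwa [List.take_of_length_le hw.length_eq.le, List.take_of_length_le hw'.length_eq.le] at this

end Tunnels

/-! ### The path `psi σ` is Dyck, and where its tunnels open -/

section Psi

variable {n : ℕ} {σ : Equiv.Perm (Fin n)}

theorem length_psi (σ : Equiv.Perm (Fin n)) : (psi σ).length = 2 * n := by
  simp [psi]
  ring

theorem getElem?_psi_left (t : Fin n) :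
    (psi σ)[(σ t : ℕ)]? = some (if IsBumped σ t then D else U) := by
  rw [psi, List.getElem?_append_left (by simp)]
  simp [mem_firstRows_fst, IsBumped, ← not_exists, ite_not]
  congr

theorem getElem?_psi_right (t : Fin n) :
    (psi σ)[2 * n - 1 - (t : ℕ)]? = some (if IsBumper σ t then U else D) := by
  have ht := t.2
  rw [psi, List.getElem?_append_right (by simp; omega)]
  have h1 : n - 1 - (2 * n - 1 - (t : ℕ) - n) = t := by omega
  have h2 : 2 * n - 1 - (t : ℕ) - n < n := by omega
  simp only [List.map_reverse, List.length_map, List.length_range]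
  rw [List.getElem?_reverse (by simpa using h2)]
  simp [h1, mem_firstRows_snd, IsBumper, ← not_exists, ite_not]
  congr

theorem heightL_succ (t : Fin n) :
    heightL σ (σ t + 1) = heightL σ (σ t) + if IsBumped σ t then -1 else 1 := by
  have h : #{s : Fin n | IsBumped σ s ∧ (σ s : ℕ) < σ t + 1} =
      #{s : Fin n | IsBumped σ s ∧ (σ s : ℕ) < σ t} + if IsBumped σ t then 1 else 0 := by
    have h' : (if IsBumped σ t then 1 else 0) = ∑ s, if s = t ∧ IsBumped σ s then 1 else 0 := by
      simp [ite_and]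
    rw [h']
    simp only [card_filter, ← sum_add_distrib]
    refine sum_congr rfl fun s _ => ?_
    have := perm_val_ne σ s t
    simp only [Fin.ext_iff]
    split_ifs <;> first | omega | grind
  unfold heightL
  rw [h]
  split_ifs <;> push_cast <;> ring

theorem heightR_succ (t : Fin n) :
    heightR σ (t + 1) = heightR σ t + if IsBumper σ t then -1 else 1 := by
  have h : #{s : Fin n | IsBumper σ s ∧ (s : ℕ) < t + 1} =
      #{s : Fin n | IsBumper σ s ∧ (s : ℕ) < t} + if IsBumper σ t then 1 else 0 := by
    have h' : (if IsBumper σ t then 1 else 0) = ∑ s, if s = t ∧ IsBumper σ s then 1 else 0 := by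
      simp [ite_and]
    rw [h']
    simp only [card_filter, ← sum_add_distrib]
    refine sum_congr rfl fun s _ => ?_
    simp only [Fin.ext_iff]
    split_ifs <;> first | omega | grind
  unfold heightR
  rw [h]
  split_ifs <;> push_cast <;> ring

theorem height_psi_left {j : ℕ} (hj : j ≤ n) : height (psi σ) j = heightL σ j := by
  induction j with
  | zero => simp [height, heightL]
  | succ j ih =>
    obtain ⟨t, ht⟩ : ∃ t, σ t = ⟨j, hj⟩ := σ.surjective _
    obtain rfl : (σ t : ℕ) = j := by rw [ht]
    have h1 := getElem?_psi_left (σ := σ) t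
    rw [heightL_succ]
    split_ifs at h1 ⊢ with hb
    · rw [height_succ_D h1, ih (by omega)]
      ring
    · rw [height_succ_U h1, ih (by omega)]

theorem height_psi_right {j : ℕ} (hj : j ≤ n) : height (psi σ) (2 * n - j) = heightR σ j := by
  induction hj using Nat.decreasingInduction with
  | self => rw [heightR_top, ← height_psi_left le_rfl, two_mul, Nat.add_sub_cancel]
  | of_succ j hj ih =>
    have h1 := getElem?_psi_right (σ := σ) ⟨j, hj⟩
    have h2 := heightR_succ (σ := σ) ⟨j, hj⟩
    simp only at h1 h2
    rw [show 2 * n - (j + 1) = 2 * n - 1 - j by omega] at ih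
    rw [show 2 * n - j = 2 * n - 1 - j + 1 by omega]
    split_ifs at h1 h2 with hb
    · rw [height_succ_U h1, ih, h2]
      ring
    · rw [height_succ_D h1, ih, h2]
      ring

theorem isDyck_psi (h : Avoids p321 σ) : IsDyck n (psi σ) := by
  have h0 : ∀ j, 0 ≤ floorHeight σ j := fun j => by unfold floorHeight; positivity
  have hend : height (psi σ) (2 * n) = 0 := by
    have := height_psi_right (σ := σ) (Nat.zero_le n)
    simpa [heightR] using this
  refine ⟨length_psi σ, fun k => ?_, hend⟩
  rcases le_total k n with hk | hk
  · rw [height_psi_left hk]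
    exact (h0 k).trans (floorHeight_le_heightL h hk)
  · rcases le_total k (2 * n) with hk' | hk'
    · rw [show k = 2 * n - (2 * n - k) by omega, height_psi_right (by omega)]
      exact (h0 _).trans (floorHeight_le_heightR h (by omega))
    · rw [height, List.take_of_length_le (by rwa [length_psi]),
        ← List.take_of_length_le (length_psi σ).le, ← height, hend]

variable {π : Equiv.Perm (Fin n)} {x y : Fin n → ℕ}

/-- A non-excedance value of `σ` is the label of an up-step of `psi σ` whose tunnel does not reach
beyond the mirror image of this up-step. -/
theorem exists_left_opener (h : Avoids p321 σ) (hT : TunnelEnds (psi σ) π x y) {t : Fin n}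
    (ht : ¬ t < σ t) : ∃ i, x i = σ t ∧ ¬ i < π i := by
  have hσ := (σ t).2
  have hU := getElem?_psi_left (σ := σ) t
  rw [if_neg fun hb => ht (hb.exc h)] at hU
  -- Otherwise the path stays above this level up to the mirror point. In the middle it meets the
  -- floor, so the floor rises through the level, and there one of the two halves touches the level.
  obtain ⟨z, hz1, hz2, hz3⟩ : ∃ z, (σ t : ℕ) < z ∧ z ≤ 2 * n - σ t ∧
      height (psi σ) z ≤ height (psi σ) (σ t) := by
    by_contra! hc
    rw [height_psi_left hσ.le] at hc
    have hn := hc n hσ (by omega)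
    rw [height_psi_left le_rfl, heightL_top h] at hn
    obtain ⟨k, hk1, hk2, -, ⟨hk3, t', ht1, ht2, -⟩ | ⟨hk3, -⟩⟩ :=
      exists_floor_step h hσ.le (floorHeight_le_heightL h hσ.le) hn
    · have hne : k ≠ σ t := by
        rintro rfl
        obtain rfl := σ.injective (Fin.ext ht2)
        exact ht ht1
      have := hc k (by omega) (by omega)
      rw [height_psi_left hk2.le] at this
      omega
    · have := hc (2 * n - k) (by omega) (by omega)
      rw [height_psi_right hk2.le] at this
      omega
  obtain ⟨y', hy', hT'⟩ := exists_tunnel_of_height_le hU hz1 hz3 (by rw [length_psi]; omega)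
  obtain ⟨i, hi⟩ := hT.exists_left (isDyck_psi h) hU
  have := hT'.right_unique (hi ▸ hT.tunnel i)
  refine ⟨i, hi, ?_⟩
  rw [hT.lt_apply_iff]
  omega

/-- An excedance position of `σ` is the label of a down-step of `psi σ` whose tunnel does not reach
beyond the mirror image of this down-step. -/
theorem exists_right_opener (h : Avoids p321 σ) (hT : TunnelEnds (psi σ) π x y) {t : Fin n}
    (ht : t < σ t) : ∃ i, y i = 2 * n - 1 - t ∧ i < π i := by
  have hD := getElem?_psi_right (σ := σ) t
  rw [if_neg fun hb => (hb.lt h).not_gt ht] at hD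
  obtain ⟨i, hi⟩ := hT.exists_right (isDyck_psi h) hD
  refine ⟨i, hi, ?_⟩
  rw [hT.lt_apply_iff]
  -- If the tunnel were not right of centre it would start at step `t` or before, so the path would
  -- be above the level throughout; the floor crossing the level again contradicts this.
  by_contra hlt
  have hc := (hT.tunnel i).above
  have he := (hT.tunnel i).height_eq
  rw [hi, show 2 * n - 1 - (t : ℕ) + 1 = 2 * n - t by omega, height_psi_right t.2.le] at he
  rw [← he] at hc
  have hn := hc n (by omega) (by omega)
  rw [height_psi_left le_rfl, heightL_top h] at hn
  obtain ⟨k, hk1, hk2, hk0, ⟨hk3, t', ht1, ht2, ht3⟩ | ⟨hk3, t', ht1, ht2, -⟩⟩ :=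
    exists_floor_step h t.2.le (floorHeight_le_heightR h t.2.le) hn
  · have hne : k ≠ t := by
      rintro rfl
      have := floorHeight_lt_heightR h ht1 ht3
      rw [ht2] at this
      omega
    have := hc k (by omega) (by omega)
    rw [height_psi_left hk2.le] at this
    omega
  · have hne : k ≠ t := by
      rintro rfl
      obtain rfl := Fin.ext ht2
      exact ht1 ht
    have := hc (2 * n - k) (by omega) (by omega)
    rw [height_psi_right hk2.le] at this
    omega

/-- The tunnel of entry `g t` has the same type as the step `t` of `σ`, and it is opened at the
down-step labelled `t` if `t` is an excedance, at the up-step labelled `σ t` otherwise. -/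
def MatchesOpeners (σ π : Equiv.Perm (Fin n)) (x y : Fin n → ℕ) (g : Equiv.Perm (Fin n)) : Prop :=
  ∀ t, (g t < π (g t) ↔ t < σ t) ∧
    (t < σ t → y (g t) = 2 * n - 1 - t) ∧ (¬ t < σ t → x (g t) = σ t)

/-- The tunnels of `psi σ` correspond to the steps of `σ` that open an arc. -/
theorem exists_opener_equiv (h : Avoids p321 σ) (hT : TunnelEnds (psi σ) π x y) :
    ∃ g : Equiv.Perm (Fin n), MatchesOpeners σ π x y g := by
  have h1 : ∀ t, ∃ i, (i < π i ↔ t < σ t) ∧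
      (t < σ t → y i = 2 * n - 1 - t) ∧ (¬ t < σ t → x i = σ t) := by
    intro t
    by_cases ht : t < σ t
    · obtain ⟨i, hi, hi'⟩ := exists_right_opener h hT ht
      exact ⟨i, by tauto, fun _ => hi, fun hn => absurd ht hn⟩
    · obtain ⟨i, hi, hi'⟩ := exists_left_opener h hT ht
      exact ⟨i, by tauto, fun hn => absurd hn ht, fun _ => hi⟩
  choose g hg using h1
  have hinj : Function.Injective g := by
    intro s t hst
    have hs := hg s
    have ht := hg t
    rw [hst] at hs
    by_cases hlt : t < σ t
    · have e1 := hs.2.1 (hs.1.1 (ht.1.2 hlt))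
      have e2 := ht.2.1 hlt
      exact Fin.ext (by omega)
    · have e1 := hs.2.2 fun hc => hlt (ht.1.1 (hs.1.2 hc))
      have e2 := ht.2.2 hlt
      exact σ.injective (Fin.ext (e1.symm.trans e2))
  exact ⟨Equiv.ofBijective g (Finite.injective_iff_bijective.1 hinj), hg⟩

theorem psi_injective {σ' : Equiv.Perm (Fin n)} (h : Avoids p321 σ) (h' : Avoids p321 σ')
    (hpsi : psi σ = psi σ') : σ = σ' := by
  obtain ⟨π, hπ⟩ := (isDyck_psi h).exists_isPhiInv
  obtain ⟨x, y, hT⟩ := hπ.exists_tunnelEnds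
  -- The openers are read off from the tunnels alone, so two preimages share excedance positions and
  -- non-excedance values.
  have key : ∀ {σ σ' : Equiv.Perm (Fin n)}, Avoids p321 σ → Avoids p321 σ' →
      TunnelEnds (psi σ) π x y → TunnelEnds (psi σ') π x y →
      (∀ t, t < σ t → t < σ' t) ∧ ∀ v, ¬ σ.symm v < v → ¬ σ'.symm v < v := by
    intro σ σ' h h' hT hT'
    obtain ⟨g, hg⟩ := exists_opener_equiv h hT
    obtain ⟨g', hg'⟩ := exists_opener_equiv h' hT'
    constructor
    · intro t ht
      obtain ⟨s, hs⟩ := g'.surjective (g t)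
      have h1 := hg' s
      rw [hs, (hg t).1] at h1
      have e := (hg t).2.1 ht
      rw [h1.2.1 (h1.1.1 ht)] at e
      obtain rfl : s = t := Fin.ext (by omega)
      exact h1.1.1 ht
    · intro v hv
      obtain ⟨t, rfl⟩ := σ.surjective v
      rw [σ.symm_apply_apply] at hv
      obtain ⟨s, hs⟩ := g'.surjective (g t)
      have h1 := hg' s
      rw [hs, (hg t).1] at h1
      have e := (hg t).2.2 hv
      rw [h1.2.2 fun hc => hv (h1.1.2 hc)] at e
      rw [← Fin.ext e, σ'.symm_apply_apply]
      exact fun hc => hv (h1.1.2 hc)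
  have hT' : TunnelEnds (psi σ') π x y := hpsi ▸ hT
  have k1 := key h h' hT hT'
  have k2 := key h' h hT' hT
  exact h.ext_excedance h' (fun t => ⟨k1.1 t, k2.1 t⟩)
    fun v => not_iff_not.1 ⟨k1.2 v, k2.2 v⟩

end Psi

/-! ### Crossings of `π` computed from the tunnels -/

section Crossings

variable {n : ℕ}

/-- A symmetric sum over unordered pairs does not depend on the ordering used; this replaces the
index order by opening time. -/
theorem sum_lt_eq_sum_lt {F : Fin n → Fin n → ℤ} (hF : ∀ i j, F i j = F j i) {a b : Fin n → ℕ}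
    (ha : Function.Injective a) (hb : Function.Injective b) :
    (∑ i, ∑ j, if a i < a j then F i j else 0) = ∑ i, ∑ j, if b i < b j then F i j else 0 := by
  have key : ∀ {a : Fin n → ℕ}, Function.Injective a →
      2 * (∑ i, ∑ j, if a i < a j then F i j else 0) = ∑ i, ∑ j, if i = j then 0 else F i j := by
    intro a ha
    have h : (∑ i, ∑ j, if a i < a j then F i j else 0) =
        ∑ i, ∑ j, if a j < a i then F i j else 0 := by
      rw [sum_comm]
      refine sum_congr rfl fun i _ => sum_congr rfl fun j _ => ?_
      rw [hF]
    rw [two_mul]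
    nth_rewrite 2 [h]
    simp only [← sum_add_distrib]
    refine sum_congr rfl fun i _ => sum_congr rfl fun j _ => ?_
    have := ha.eq_iff (a := i) (b := j)
    split_ifs <;> omega
  have h1 := key ha
  rw [← key hb] at h1
  omega

variable {σ π : Equiv.Perm (Fin n)} {w : List DyckStep} {x y : Fin n → ℕ}

/-- The rank of a tunnel in the order in which the tunnels are opened when the steps of the path
are read alternately from its two ends. -/
def openTime (π : Equiv.Perm (Fin n)) (x y : Fin n → ℕ) (i : Fin n) : ℕ :=
  if i < π i then 2 * (2 * n - 1 - y i) + 1 else 2 * x i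

namespace TunnelEnds

theorem left_injective (h : TunnelEnds w π x y) : Function.Injective x := fun i j hij => by
  by_contra hne
  rcases lt_or_gt_of_ne hne with hlt | hlt <;> exact (h.left_lt_left.2 hlt).ne (by rw [hij])

theorem right_injective (h : TunnelEnds w π x y) : Function.Injective y := fun i j hij => by
  by_contra hne
  rcases lt_or_gt_of_ne (π.injective.ne hne) with hlt | hlt <;>
    exact (h.right_lt_right.2 hlt).ne (by rw [hij])

theorem openTime_injective (h : TunnelEnds w π x y) (hw : IsDyck n w) :
    Function.Injective (openTime π x y) := by
  intro i j hij
  have h1 := h.right_lt hw i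
  have h2 := h.right_lt hw j
  unfold openTime at hij
  split_ifs at hij
  · exact h.right_injective (by omega)
  · omega
  · omega
  · exact h.left_injective (by omega)

/-- Each tunnel `j` contributes the signs of the earlier opened tunnels that are disjoint from it. -/
theorem crs_add_exc (h : TunnelEnds w π x y) (hw : IsDyck n w) :
    (crs π + exc π : ℤ) = ∑ j, -(sgn π j * ∑ i,
      if openTime π x y i < openTime π x y j ∧ (y i < x j ∨ y j < x i) then sgn π i else 0) := by
  have hF : ∀ i j : Fin n, (if y i < x j ∨ y j < x i then sgn π i * sgn π j else 0) =
      if y j < x i ∨ y i < x j then sgn π j * sgn π i else 0 := by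
    intro i j
    rw [mul_comm]
    exact if_congr or_comm rfl rfl
  have h1 := sum_lt_eq_sum_lt hF Fin.val_injective (h.openTime_injective hw)
  rw [ElizaldePak.crs_add_exc, sum_neg_distrib, neg_inj]
  trans ∑ i : Fin n, ∑ j : Fin n, if (i : ℕ) < j then
      (if y i < x j ∨ y j < x i then sgn π i * sgn π j else 0) else 0
  · refine sum_congr rfl fun i _ => sum_congr rfl fun j _ => ?_
    rw [← ite_and]
    refine if_congr ?_ rfl rfl
    have h2 := h.left_lt_left (i := j) (j := i)
    have h3 := h.right_lt_right (i := j) (j := i)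
    have h4 := (h.tunnel i).lt
    have h5 := (h.tunnel j).lt
    have h6 := (h.tunnel j).noncrossing (h.tunnel i)
    rw [← h2, ← h3, ← Fin.lt_def, ← h2]
    omega
  · rw [h1, sum_comm]
    refine sum_congr rfl fun j _ => ?_
    rw [mul_sum]
    refine sum_congr rfl fun i _ => ?_
    rw [← ite_and, mul_ite, mul_zero, mul_comm]

/-- Excedance tunnels opened earlier from the right are disjoint from `j` unless they enclose it;
non-excedance tunnels opened earlier are disjoint only if they closed before `x j`. -/
theorem sum_sgn_of_left (h : TunnelEnds w π x y) (hw : IsDyck n w) {j : Fin n}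
    (hj : ¬ j < π j) :
    (∑ i, if openTime π x y i < openTime π x y j ∧ (y i < x j ∨ y j < x i) then sgn π i else 0) =
      (#{i | 2 * n - x j ≤ y i ∧ x j ≤ x i} : ℤ) - #{i | y i < x j} := by
  simp only [card_filter, Nat.cast_sum, ← sum_sub_distrib]
  refine sum_congr rfl fun i _ => ?_
  have h1 := (h.tunnel i).lt
  have h2 := (h.tunnel j).lt
  have h3 := (h.tunnel i).noncrossing (h.tunnel j)
  have h4 := (h.tunnel j).noncrossing (h.tunnel i)
  have h5 := h.right_lt hw i
  have h6 := h.right_lt hw j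
  have h7 := h.left_injective.eq_iff (a := i) (b := j)
  have h8 : i = j → y i = y j := fun e => e ▸ rfl
  unfold openTime sgn
  simp only [h.lt_apply_iff] at hj ⊢
  simp only [if_neg hj]
  by_cases hi : 2 * n ≤ x i + y i
  · simp only [if_pos hi]
    split_ifs <;> push_cast <;> omega
  · simp only [if_neg hi]
    split_ifs <;> push_cast <;> omega

theorem sum_sgn_of_right (h : TunnelEnds w π x y) (hw : IsDyck n w) {j : Fin n} (hj : j < π j)
    {k : ℕ} (hk : y j = 2 * n - 1 - k) (hkn : k < n) :
    (∑ i, if openTime π x y i < openTime π x y j ∧ (y i < x j ∨ y j < x i) then sgn π i else 0) =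
      (#{i | 2 * n - k ≤ x i} : ℤ) - #{i | x i ≤ k ∧ y i < 2 * n - k} := by
  simp only [card_filter, Nat.cast_sum, ← sum_sub_distrib]
  refine sum_congr rfl fun i _ => ?_
  have h1 := (h.tunnel i).lt
  have h2 := (h.tunnel j).lt
  have h3 := (h.tunnel i).noncrossing (h.tunnel j)
  have h4 := (h.tunnel j).noncrossing (h.tunnel i)
  have h5 := h.right_lt hw i
  have h6 := h.right_lt hw j
  have h7 := h.left_injective.eq_iff (a := i) (b := j)
  have h8 := h.right_injective.eq_iff (a := i) (b := j)
  unfold openTime sgn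
  simp only [h.lt_apply_iff] at hj ⊢
  simp only [if_pos hj]
  by_cases hi : 2 * n ≤ x i + y i
  · simp only [if_pos hi]
    split_ifs <;> push_cast <;> omega
  · simp only [if_neg hi]
    split_ifs <;> push_cast <;> omega

end TunnelEnds

variable {g : Equiv.Perm (Fin n)}

theorem MatchesOpeners.exc_eq (hg : MatchesOpeners σ π x y g) : exc π = exc σ := by
  refine (card_equiv g fun t => ?_).symm
  simp [(hg t).1]

/-- By `cut_add`, `cut σ k` is determined by the number of arcs opened below `k`, and `g` turns
these into tunnels opened within the outer `k` steps at either end. -/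
theorem MatchesOpeners.cut_eq (hg : MatchesOpeners σ π x y g)
    (h : TunnelEnds w π x y) (hw : IsDyck n w) {k : ℕ} (hk : k ≤ n) :
    cut σ k + #{i | y i < k} = #{i | 2 * n - k ≤ y i ∧ k ≤ x i} := by
  have h1 : #{t : Fin n | t < σ t ∧ (t : ℕ) < k} = #{i : Fin n | i < π i ∧ 2 * n - k ≤ y i} := by
    refine card_equiv g fun t => ?_
    simp only [mem_filter, mem_univ, true_and, (hg t).1]
    refine and_congr_right fun ht => ?_
    rw [(hg t).2.1 ht]
    omega
  have h2 : #{t : Fin n | ¬ t < σ t ∧ (σ t : ℕ) < k} = #{i : Fin n | ¬ i < π i ∧ x i < k} := by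
    refine card_equiv g fun t => ?_
    simp only [mem_filter, mem_univ, true_and, (hg t).1]
    refine and_congr_right fun ht => ?_
    rw [(hg t).2.2 ht]
  have h3 : #{i : Fin n | i < π i ∧ 2 * n - k ≤ y i} + #{i : Fin n | ¬ i < π i ∧ x i < k} =
      #{i | 2 * n - k ≤ y i ∧ k ≤ x i} + #{i | x i < k} := by
    simp only [card_filter, ← sum_add_distrib]
    refine sum_congr rfl fun i _ => ?_
    have h4 := (h.tunnel i).lt
    have h5 := h.right_lt hw i
    simp only [h.lt_apply_iff]
    split_ifs <;> omega
  have h6 := cut_add σ hk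
  have h7 := h.card_add hw (k := k) (by omega)
  omega

theorem MatchesOpeners.cut_succ_eq (hg : MatchesOpeners σ π x y g)
    (h : TunnelEnds w π x y) (hw : IsDyck n w) {t : Fin n}
    (ht : t < σ t) : cut σ (t + 1) + #{i | 2 * n - t ≤ x i} =
      #{i | x i ≤ t ∧ y i < 2 * n - t} := by
  have h1 := hg.cut_eq h hw (k := t + 1) t.2
  have h2 := h.card_add hw (k := t + 1) (by omega)
  have h3 := h.card_add hw (k := 2 * n - t) (by omega)
  have h4 := (hg t).2.1 ht
  have h5 := (hg t).1.2 ht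
  rw [h.lt_apply_iff] at h5
  have e2 : ∑ _i : Fin n, 1 = n := by simp
  -- The extra `1` is the tunnel `g t`, the only one ending at step `2 * n - 1 - t`.
  have h6 : #{i | 2 * n - (t + 1) ≤ y i ∧ t + 1 ≤ x i} + #{i | x i < t + 1} +
      #{i | y i < 2 * n - t} = #{i | x i ≤ t ∧ y i < 2 * n - t} + 1 + ∑ _i : Fin n, 1 := by
    have e1 : (1 : ℕ) = ∑ i, if i = g t then 1 else 0 := by simp
    rw [e1]
    simp only [card_filter, ← sum_add_distrib]
    refine sum_congr rfl fun i _ => ?_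
    have h8 := h.right_injective.eq_iff (a := i) (b := g t)
    have h9 := (h.tunnel i).lt
    have h10 : i = g t → x i = x (g t) := fun e => e ▸ rfl
    have h11 := t.2
    split_ifs <;> omega
  have h7 : #{i | 2 * n - t ≤ x i} + #{i | x i < 2 * n - t} = ∑ _i : Fin n, 1 := by
    simp only [card_filter, ← sum_add_distrib]
    refine sum_congr rfl fun i _ => ?_
    split_ifs <;> omega
  rw [e2] at h6 h7
  omega

theorem MatchesOpeners.crs_add_exc (hg : MatchesOpeners σ π x y g)
    (h : TunnelEnds w π x y) (hw : IsDyck n w) :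
    crs π + exc π = cutSum σ := by
  zify
  rw [h.crs_add_exc hw, ← Equiv.sum_comp g, cutSum]
  push_cast
  refine sum_congr rfl fun t _ => ?_
  split_ifs with ht
  · have h1 := hg.cut_succ_eq h hw ht
    rw [h.sum_sgn_of_right hw ((hg t).1.2 ht) ((hg t).2.1 ht) t.2, sgn, if_pos ((hg t).1.2 ht)]
    omega
  · have h1 := hg.cut_eq h hw (σ t).2.le
    have ht' : ¬ g t < π (g t) := fun hc => ht ((hg t).1.1 hc)
    rw [h.sum_sgn_of_left hw ht', sgn, if_neg ht', (hg t).2.2 ht]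
    omega

theorem crs_eq_of_isPhiInv (h : Avoids p321 σ) (hπ : IsPhiInv (psi σ) π) : crs π = crs σ := by
  obtain ⟨x, y, hT⟩ := hπ.exists_tunnelEnds
  obtain ⟨g, hg⟩ := exists_opener_equiv h hT
  have h1 := hg.crs_add_exc hT (isDyck_psi h)
  have h2 := hg.exc_eq
  have h3 := h.crs_add_exc
  omega

end Crossings

end ElizaldePak

theorem mainTheorem2 (n : ℕ) :
    ∃ Θ : ElizaldePak.Av n ElizaldePak.p321 ≃ ElizaldePak.Av n ElizaldePak.p132,
      ElizaldePak.IsElizaldePakMap Θ ∧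
      ∀ σ : ElizaldePak.Av n ElizaldePak.p321,
        ElizaldePak.crs (Θ σ).1 = ElizaldePak.crs σ.1 := by
  open ElizaldePak in
  choose f hf using fun σ : Av n p321 => (isDyck_psi σ.2).exists_isPhiInv
  let F : Av n p321 → Av n p132 := fun σ =>
    ⟨f σ, by obtain ⟨x, y, hT⟩ := (hf σ).exists_tunnelEnds; exact hT.avoids⟩
  have hF : Function.Injective F := by
    intro σ σ' he
    have he' : f σ = f σ' := congrArg Subtype.val he
    have hpsi := IsPhiInv.path_unique (isDyck_psi σ.2) (isDyck_psi σ'.2) (hf σ) (he' ▸ hf σ')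
    exact Subtype.ext (psi_injective σ.2 σ'.2 hpsi)
  -- `G` need not invert `F`; it only supplies the reverse inequality of cardinalities.
  obtain ⟨G, hG⟩ := exists_injective_av n
  have : Finite (Av n p321) := inferInstanceAs (Finite {σ : Equiv.Perm (Fin n) // _})
  have : Finite (Av n p132) := inferInstanceAs (Finite {σ : Equiv.Perm (Fin n) // _})
  have hcard : Nat.card (Av n p321) = Nat.card (Av n p132) :=
    le_antisymm (Nat.card_le_card_of_injective F hF) (Nat.card_le_card_of_injective G hG)
  refine ⟨Equiv.ofBijective F ((Nat.bijective_iff_injective_and_card F).2 ⟨hF, hcard⟩), ?_, ?_⟩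
  · exact fun σ => ⟨isDyckPath_iff.2 (isDyck_psi σ.2), hf σ⟩
  · exact fun σ => crs_eq_of_isPhiInv σ.2 (hf σ)
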